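/- Let $d_A,d_B\ge 2$, $\mathcal H_A=\mathbb C^{d_A}$, $\mathcal H_B=\mathbb C^{d_B}$, let $\mathcal E$ be a quantum channel (completely positive trace-preserving map) on $\mathcal B(\mathcal H_A\otimes\mathcal H_B)$, $\rho$ a density matrix and $M$ a Hermitian operator on $\mathcal H_A\otimes\mathcal H_B$. Write $|\mathrm{vec}(\cdot)\rangle$ for vectorization ($|a\rangle\langle b|\mapsto|a\rangle\otimes|b\rangle$) and $\boldsymbol{\mathcal F}$ for the Liouville matrix of a linear map $\mathcal F$ ($\boldsymbol{\mathcal F}|\mathrm{vec}(Z)\rangle=|\mathrm{vec}(\mathcal F(Z))\rangle$); $\mathcal U(Z)=UZU^\dagger$. Put $$P_X=\int \boldsymbol{\mathcal U}^{\otimes2}\,d\mu_{\rm Haar}(U)\quad(X=A,B),\qquad P_{AB}=\iint(\boldsymbol{\mathcal U}_A\otimes\boldsymbol{\mathcal U}_B)^{\otimes 2}\,d\mu_{\rm Haar}(U_A)\,d\mu_{\rm Haar}(U_B).$$ A finite gate set $\Gamma=\{U_1,\dots,U_N\}$ is a unitary 2-design if $\frac1N\sum_i\boldsymbol{\mathcal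 U}_i^{\otimes2}=\int\boldsymbol{\mathcal U}^{\otimes2}d\mu_{\rm Haar}(U)$. For gate sets $\Gamma_A,\Gamma_B$ and a depth $k\ge1$, let $s=(s_A,s_B)$ with $s_A=(a_1,\dots,a_k)$, $s_B=(b_1,\dots,b_k)$ be uniformly random sequences of gates, let every gate carry the same noise, $\tilde{\mathcal U}_s=(\mathcal U_{a_k}\otimes\mathcal U_{b_k})\circ\mathcal E\circ\cdots\circ(\mathcal U_{a_1}\otimes\mathcal U_{b_1})\circ\mathcal E$, and let $m(s)=\mathrm{tr}[M\,\tilde{\mathcal U}_s(\rho)]$. Let $X_0=I/\sqrt{d_A},X_1,\dots,X_{d_A^2-1}$ and $Y_0=I/\sqrt{d_B},Y_1,\dots,Y_{d_B^2-1}$ be Hilbert–Schmidt orthonormal operator bases on $A$ and $B$. The sectors are $A=\{X_i\otimes Y_0\}$, $AB=\{X_i\otimes Y_j\}$, $B=\{X_0\otimes Y_j\}$ ($i,j\ge1$); $T_{S\to S'}$ is the block of $\boldsymbol{\mathcal E}$ in the basis $\{X_\mu\otimes Y_\nu\}$ from sector $S$ to sector $S'$; $\alpha_A=\frac1{d_A^2-1}$,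 $\alpha_B=\frac1{d_B^2-1}$, $\alpha_{AB}=\alpha_A\alpha_B$; $u_{S\to S'}=\alpha_S\,\mathrm{tr}[T_{S\to S'}^\dagger T_{S\to S'}]$; and $x_S$ is the sum of $|\mathrm{tr}(Z^\dagger\mathcal E(X_0\otimes Y_0))|^2$ over the basis elements $Z$ of the sector $S$. The sub-unitarity matrix is $$\mathcal S=\begin{pmatrix}u_{A\to A}&\frac1{\sqrt{\alpha_B}}u_{AB\to A}&\sqrt{\frac{\alpha_A}{\alpha_B}}\,u_{B\to A}\\ \sqrt{\alpha_B}\,u_{A\to AB}&u_{AB\to AB}&\sqrt{\alpha_A}\,u_{B\to AB}\\ \sqrt{\frac{\alpha_B}{\alpha_A}}\,u_{A\to B}&\frac1{\sqrt{\alpha_A}}u_{AB\to B}&u_{B\to B}\end{pmatrix}.$$ Then: 1. $P_A$ and $P_B$ are the orthogonal projectors onto $\mathrm{span}\{|\mathrm{vec}(I\otimes I)\rangle,|\mathrm{vec}(\mathbb F)\rangle\}$, where $\mathbb F$ is the flip of two copies of the respective system, and $P_{AB}=P_A\otimes P_B$ up to the reordering of tensor factors. 2. If $\Gamma_A$ and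 $\Gamma_B$ are unitary 2-designs, then for every $k\ge2$ $$\mathbb E_s[m(s)^2]=\langle \mathrm{vec}(M)|^{\otimes2}\,(P_{AB}\boldsymbol{\mathcal E}^{\otimes2}P_{AB})^{k-1}\,|\mathrm{vec}(\mathcal E(\rho))\rangle^{\otimes2},$$ and for $k=1$ the same holds with the zeroth power read as $P_{AB}$. 3. Let $|0\rangle=|\mathrm{vec}X_0\rangle\otimes|\mathrm{vec}X_0\rangle$, $|1\rangle=\sqrt{\alpha_A}\sum_{i\ge1}|\mathrm{vec}X_i\rangle\otimes|\mathrm{vec}X_i^\dagger\rangle$ on two copies of $A$, similarly on $B$, and $|ij\rangle=|i\rangle_A\otimes|j\rangle_B$. Then $|00\rangle,|10\rangle,|11\rangle,|01\rangle$ are orthonormal, $P_{AB}=\sum_{ij}|ij\rangle\langle ij|$, and in this ordered basis of the range of $P_{AB}$ the matrix of $P_{AB}\boldsymbol{\mathcal E}^{\otimes2}P_{AB}$ is $\begin{pmatrix}1&0\\ \mathbf x&\mathcal S\end{pmatrix}$ with $\mathbf x=(\sqrt{\alpha_A}x_A,\sqrt{\alpha_A\alpha_B}x_{AB},\sqrt{\alpha_B}x_B)^T$.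 4. If $\mathcal S$ is diagonalizable over $\mathbb C$ with eigenvalues $\lambda_1,\lambda_2,\lambda_3$ (with multiplicity), there are complex constants $c_0,\dots,c_3$, independent of $k$ and of the choice of the 2-designs $\Gamma_A,\Gamma_B$, with $\mathbb E_s[m(s)^2]=c_0+c_1\lambda_1^{k-1}+c_2\lambda_2^{k-1}+c_3\lambda_3^{k-1}$ for all $k\ge1$. For arbitrary $\mathcal S$ there are complex constants $c_0,c_{\lambda,j}$, independent in the same way, such that for all $k\ge1$ $$\mathbb E_s[m(s)^2]=c_0+\sum_{\lambda}\sum_{j=0}^{m_\lambda-1}c_{\lambda,j}\binom{k-1}{j}\lambda^{k-1-j},$$ where $\lambda$ runs over the distinct eigenvalues of $\mathcal S$ and $m_\lambda$ is the algebraic multiplicity of $\lambda$ (terms with $j>k-1$ are zero, and $0^0=1$). 5. If $\mathcal E$ is separable, that is $\mathcal E=\sum_k p_k\,\mathcal E_k\otimes\mathcal F_k$ is a finite convex mixture of products of channels on $A$ and on $B$, then $$\mathcal S=\begin{pmatrix}u_{A\to A}&0&0\\ \sqrt{\alpha_B}\,u_{A\to AB}&u_{AB\to AB}&\sqrt{\alpha_A}\,u_{B\to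 AB}\\0&0&u_{B\to B}\end{pmatrix},$$ which is lower triangular once its rows and columns are put in the order $A,B,AB$; the eigenvalues of $\mathcal S$, counted with multiplicity, are exactly $u_{A\to A},u_{B\to B},u_{AB\to AB}$. If moreover $\mathcal S$ is diagonalizable, then there are real constants $c_{00},c_{10},c_{01},c_{11}$, independent of $k$ and of the choice of the 2-designs, with $\mathbb E_s[m(s)^2]=c_{00}+c_{10}u_{A\to A}^{k-1}+c_{01}u_{B\to B}^{k-1}+c_{11}u_{AB\to AB}^{k-1}$ for all $k\ge1$. -/

import Mathlib

open Matrix MeasureTheory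
open scoped Kronecker ComplexOrder

noncomputable section

namespace LocalTwirl

section General

variable {n : Type*} [Fintype n] [DecidableEq n]

/-! ### States, channels, separability -/

/-- Linear maps `B(H) → B(H)` for `H = ℂⁿ`. -/
abbrev SuperOp (n : Type*) := Matrix n n ℂ →ₗ[ℂ] Matrix n n ℂ

/-- Density matrices. -/
def IsState (ρ : Matrix n n ℂ) : Prop := ρ.PosSemidef ∧ ρ.trace = 1

/-- The amplification `id_m ⊗ E`, acting on an `m × m` block matrix block by block. -/
def amplify (E : SuperOp n) (m : ℕ) (Z : Matrix (Fin m × n) (Fin m × n) ℂ) :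
    Matrix (Fin m × n) (Fin m × n) ℂ :=
  Matrix.of fun p q => E (Matrix.of fun a b => Z (p.1, a) (q.1, b)) p.2 q.2

/-- Quantum channels: completely positive, trace preserving linear maps. -/
def IsChannel (E : SuperOp n) : Prop :=
  (∀ (m : ℕ) (Z : Matrix (Fin m × n) (Fin m × n) ℂ),
    Z.PosSemidef → (amplify E m Z).PosSemidef) ∧
  ∀ Z, (E Z).trace = Z.trace

/-- The tensor product `E ⊗ F` of two linear maps, see `tensorMap_kronecker`. -/
def tensorMap {a b : Type*} [Fintype a] [DecidableEq a] [Fintype b] [DecidableEq b]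
    (E : SuperOp a) (F : SuperOp b) : SuperOp (a × b) where
  toFun Z := ∑ p : a × b, ∑ q : a × b,
    Z p q • (E (Matrix.single p.1 q.1 1) ⊗ₖ F (Matrix.single p.2 q.2 1))
  map_add' Z W := by
    simp only [Matrix.add_apply, add_smul, Finset.sum_add_distrib]
  map_smul' c Z := by
    simp only [Matrix.smul_apply, smul_eq_mul, mul_smul, Finset.smul_sum, RingHom.id_apply]

theorem tensorMap_kronecker {a b : Type*} [Fintype a] [DecidableEq a] [Fintype b]
    [DecidableEq b] (E : SuperOp a) (F : SuperOp b) (Z : Matrix a a ℂ) (W : Matrix b b ℂ) :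
    tensorMap E F (Z ⊗ₖ W) = E Z ⊗ₖ F W := by
  have hE : E Z = ∑ i, ∑ j, Z i j • E (Matrix.single i j 1) := by
    conv_lhs => rw [Matrix.matrix_eq_sum_single Z]
    simp only [map_sum]
    refine Finset.sum_congr rfl fun i _ => Finset.sum_congr rfl fun j _ => ?_
    rw [← map_smul, Matrix.smul_single, smul_eq_mul, mul_one]
  have hF : F W = ∑ i, ∑ j, W i j • F (Matrix.single i j 1) := by
    conv_lhs => rw [Matrix.matrix_eq_sum_single W]
    simp only [map_sum]
    refine Finset.sum_congr rfl fun i _ => Finset.sum_congr rfl fun j _ => ?_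
    rw [← map_smul, Matrix.smul_single, smul_eq_mul, mul_one]
  ext ⟨i, i'⟩ ⟨j, j'⟩
  rw [hE, hF]
  simp only [tensorMap, LinearMap.coe_mk, AddHom.coe_mk, Matrix.sum_apply, Matrix.smul_apply,
    Matrix.kroneckerMap_apply, smul_eq_mul, Fintype.sum_prod_type, Finset.sum_mul_sum]
  refine Finset.sum_congr rfl fun x _ => Finset.sum_congr rfl fun y _ => ?_
  refine Finset.sum_congr rfl fun z _ => Finset.sum_congr rfl fun w _ => ?_
  ring

/-- Separable channels: finite convex mixtures of product channels. -/
def IsSeparableChannel {a b : Type*} [Fintype a] [DecidableEq a] [Fintype b] [DecidableEq b]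
    (E : SuperOp (a × b)) : Prop :=
  ∃ (r : ℕ) (p : Fin r → ℝ) (F : Fin r → SuperOp a) (G : Fin r → SuperOp b),
    (∀ k, 0 ≤ p k) ∧ ∑ k, p k = 1 ∧ (∀ k, IsChannel (F k)) ∧ (∀ k, IsChannel (G k)) ∧
    E = ∑ k, (p k : ℂ) • tensorMap (F k) (G k)

/-! ### Liouville representation -/

/-- Vectorization, `|a⟩⟨b| ↦ |a⟩ ⊗ |b⟩`. -/
def vectorize (Z : Matrix n n ℂ) : n × n → ℂ := fun p => Z p.1 p.2

/-- `|vec Z⟩ ⊗ |vec W⟩`, a vector of the two-copy space. -/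
def vecTensor (Z W : Matrix n n ℂ) : (n × n) × (n × n) → ℂ :=
  fun p => vectorize Z p.1 * vectorize W p.2

/-- Vectorization of an operator on two copies of the system, with the tensor factors
reordered so that `Z ⊗ W` is sent to `|vec Z⟩ ⊗ |vec W⟩`. -/
def vectorizeTwo (Z : Matrix (n × n) (n × n) ℂ) : (n × n) × (n × n) → ℂ :=
  fun p => Z (p.1.1, p.2.1) (p.1.2, p.2.2)

/-- The flip operator on two copies of the system. -/
def flipOp (n : Type*) [DecidableEq n] : Matrix (n × n) (n × n) ℂ :=
  Matrix.of fun p q => if p.1 = q.2 ∧ p.2 = q.1 then 1 else 0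

/-- The Liouville representation, see `liouville_mulVec_vectorize`. -/
def liouville (E : SuperOp n) : Matrix (n × n) (n × n) ℂ :=
  Matrix.of fun p q => vectorize (E (Matrix.single q.1 q.2 1)) p

theorem liouville_mulVec_vectorize (E : SuperOp n) (Z : Matrix n n ℂ) :
    liouville E *ᵥ vectorize Z = vectorize (E Z) := by
  have hE : E Z = ∑ i, ∑ j, Z i j • E (Matrix.single i j 1) := by
    conv_lhs => rw [Matrix.matrix_eq_sum_single Z]
    simp only [map_sum]
    refine Finset.sum_congr rfl fun i _ => Finset.sum_congr rfl fun j _ => ?_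
    rw [← map_smul, Matrix.smul_single, smul_eq_mul, mul_one]
  ext p
  rw [hE]
  simp [Matrix.mulVec, dotProduct, liouville, vectorize, Fintype.sum_prod_type,
    Matrix.sum_apply, mul_comm]

/-- `E^{⊗2}` in the Liouville representation. -/
def liouvilleTwo (E : SuperOp n) : Matrix ((n × n) × (n × n)) ((n × n) × (n × n)) ℂ :=
  liouville E ⊗ₖ liouville E

/-- The map `Z ↦ U Z U†`. -/
def conjMap (U : Matrix n n ℂ) : SuperOp n where
  toFun Z := U * Z * Uᴴ
  map_add' Z W := by rw [Matrix.mul_add, Matrix.add_mul]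
  map_smul' c Z := by simp

/-! ### Haar measure, twirls, unitary 2-designs -/

instance : MeasurableSpace (Matrix.unitaryGroup n ℂ) := borel _

instance : BorelSpace (Matrix.unitaryGroup n ℂ) := ⟨rfl⟩

instance : CompactSpace (Matrix.unitaryGroup n ℂ) := by
  have hK : IsCompact (Set.pi Set.univ fun _ : n => Set.pi Set.univ fun _ : n =>
      Metric.closedBall (0 : ℂ) 1) :=
    isCompact_univ_pi fun _ => isCompact_univ_pi fun _ => isCompact_closedBall 0 1
  have hcl : IsClosed (Matrix.unitaryGroup n ℂ : Set (Matrix n n ℂ)) := by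
    have : (Matrix.unitaryGroup n ℂ : Set (Matrix n n ℂ)) =
        {U | star U * U = 1} ∩ {U | U * star U = 1} := by
      ext U
      exact Unitary.mem_iff
    rw [this]
    exact (isClosed_eq (by fun_prop) continuous_const).inter
      (isClosed_eq (by fun_prop) continuous_const)
  refine isCompact_iff_compactSpace.mp (IsCompact.of_isClosed_subset hK hcl ?_)
  intro U hU i _ j _
  simpa using entry_norm_bound_of_unitary hU i j

/-- The normalized Haar measure on the unitary group. -/
def haarU (n : Type*) [Fintype n] [DecidableEq n] : Measure (Matrix.unitaryGroup n ℂ) :=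
  Measure.haarMeasure ⊤

/-- `P = ∫ 𝐔^{⊗2} dμ_Haar(U)` (an integral of matrices, taken entrywise). -/
def twirl (n : Type*) [Fintype n] [DecidableEq n] :
    Matrix ((n × n) × (n × n)) ((n × n) × (n × n)) ℂ :=
  Matrix.of fun p q => ∫ U, liouvilleTwo (conjMap (U : Matrix n n ℂ)) p q ∂(haarU n)

/-- `P_AB = ∫ ∫ (𝐔_A ⊗ 𝐔_B)^{⊗2} dμ_Haar(U_A) dμ_Haar(U_B)`. -/
def localTwirl (a b : Type*) [Fintype a] [DecidableEq a] [Fintype b] [DecidableEq b] :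
    Matrix (((a × b) × (a × b)) × ((a × b) × (a × b)))
      (((a × b) × (a × b)) × ((a × b) × (a × b))) ℂ :=
  Matrix.of fun p q => ∫ U, ∫ V,
    liouvilleTwo (conjMap ((U : Matrix a a ℂ) ⊗ₖ (V : Matrix b b ℂ))) p q
      ∂(haarU b) ∂(haarU a)

/-- A finite gate set `{U_1, …, U_N}`, with the uniform distribution, is a unitary 2-design. -/
def IsTwoDesign {N : ℕ} (Γ : Fin N → Matrix.unitaryGroup n ℂ) : Prop :=
  (1 / (N : ℂ)) • ∑ i, liouvilleTwo (conjMap (Γ i : Matrix n n ℂ)) = twirl n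

end General

section Bipartite

/-! ### The benchmarking signal -/

variable {dA dB : ℕ}

/-- The noisy circuit `Ũ_{s_k} ∘ ⋯ ∘ Ũ_{s_1}` with `Ũ_{s_i} = 𝒰_{a_i} ⊗ 𝒰_{b_i} ∘ E`:
every gate is preceded by the same noise channel `E`. -/
def noisyCircuit (E : SuperOp (Fin dA × Fin dB)) {NA NB : ℕ}
    (ΓA : Fin NA → Matrix.unitaryGroup (Fin dA) ℂ)
    (ΓB : Fin NB → Matrix.unitaryGroup (Fin dB) ℂ) :
    (k : ℕ) → (Fin k → Fin NA) → (Fin k → Fin NB) → SuperOp (Fin dA × Fin dB)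
  | 0, _, _ => LinearMap.id
  | k + 1, sA, sB =>
      conjMap ((ΓA (sA (Fin.last k)) : Matrix (Fin dA) (Fin dA) ℂ) ⊗ₖ
          (ΓB (sB (Fin.last k)) : Matrix (Fin dB) (Fin dB) ℂ)) ∘ₗ E ∘ₗ
        noisyCircuit E ΓA ΓB k (fun i => sA i.castSucc) (fun i => sB i.castSucc)

/-- `E_s[m(s)²]` for circuits of depth `k`, where `m(s) = tr(M Ũ_s(ρ))` and
`s = (s_A, s_B)` is uniformly distributed. -/
def signal (E : SuperOp (Fin dA × Fin dB)) {NA NB : ℕ}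
    (ΓA : Fin NA → Matrix.unitaryGroup (Fin dA) ℂ)
    (ΓB : Fin NB → Matrix.unitaryGroup (Fin dB) ℂ)
    (M ρ : Matrix (Fin dA × Fin dB) (Fin dA × Fin dB) ℂ) (k : ℕ) : ℂ :=
  (1 / ((NA : ℂ) * NB) ^ k) * ∑ sA : Fin k → Fin NA, ∑ sB : Fin k → Fin NB,
    (M * noisyCircuit E ΓA ΓB k sA sB ρ).trace ^ 2

/-! ### Operator bases and sub-unitarities -/

/-- An orthonormal operator basis `X_0 = 1/√d, X_1, …, X_{d²-1}` of the `d × d` matrices for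
the Hilbert–Schmidt inner product; the index `none` stands for `0`, and `some i` runs over
the `d² - 1` traceless elements. -/
structure OpBasis (d : ℕ) where
  X : Option (Fin (d ^ 2 - 1)) → Matrix (Fin d) (Fin d) ℂ
  zero : X none = ((1 / Real.sqrt d : ℝ) : ℂ) • (1 : Matrix (Fin d) (Fin d) ℂ)
  orthonormal : ∀ μ ν, ((X μ)ᴴ * X ν).trace = if μ = ν then 1 else 0

/-- Indices `(μ, ν)` of the product basis `X_μ ⊗ Y_ν`. -/
abbrev PairIx (dA dB : ℕ) := Option (Fin (dA ^ 2 - 1)) × Option (Fin (dB ^ 2 - 1))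

/-- The matrix entries `⟨X_μ ⊗ Y_ν| 𝐄 |X_μ' ⊗ Y_ν'⟩ = tr((X_μ ⊗ Y_ν)† E(X_μ' ⊗ Y_ν'))`. -/
def liouvilleIn (X : OpBasis dA) (Y : OpBasis dB) (E : SuperOp (Fin dA × Fin dB)) :
    Matrix (PairIx dA dB) (PairIx dA dB) ℂ :=
  Matrix.of fun p q =>
    ((X.X p.1 ⊗ₖ Y.X p.2)ᴴ * E (X.X q.1 ⊗ₖ Y.X q.2)).trace

/-- The three non-trivial sectors. -/
inductive Sector
  | A
  | AB
  | B

/-- `X_i ⊗ Y_0` belongs to `A`, `X_i ⊗ Y_j` to `AB`, and `X_0 ⊗ Y_j` to `B`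
(`i, j ≥ 1`). -/
def InSector : Sector → PairIx dA dB → Prop
  | .A, p => p.1.isSome = true ∧ p.2.isSome = false
  | .AB, p => p.1.isSome = true ∧ p.2.isSome = true
  | .B, p => p.1.isSome = false ∧ p.2.isSome = true

instance (s : Sector) : DecidablePred (InSector (dA := dA) (dB := dB) s) := fun p => by
  cases s <;> unfold InSector <;> infer_instance

/-- The block `T_{s → t}` of the Liouville matrix. -/
def block (X : OpBasis dA) (Y : OpBasis dB) (E : SuperOp (Fin dA × Fin dB)) (s t : Sector) :
    Matrix {p : PairIx dA dB // InSector t p} {p : PairIx dA dB // InSector s p} ℂ :=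
  (liouvilleIn X Y E).submatrix Subtype.val Subtype.val

/-- `α = 1 / (d² - 1)`. -/
def alpha (d : ℕ) : ℝ := 1 / ((d : ℝ) ^ 2 - 1)

/-- `α_A`, `α_AB = α_A α_B`, `α_B`. -/
def sectorAlpha (dA dB : ℕ) : Sector → ℝ
  | .A => alpha dA
  | .AB => alpha dA * alpha dB
  | .B => alpha dB

/-- The sub-unitarity `u_{s → t}(E) = α_s tr(T_{s → t}† T_{s → t})`. -/
def subU (X : OpBasis dA) (Y : OpBasis dB) (E : SuperOp (Fin dA × Fin dB)) (s t : Sector) : ℝ :=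
  sectorAlpha dA dB s * (((block X Y E s t)ᴴ * block X Y E s t).trace).re

/-- `x_t`, the squared norm of the part of the non-unital vector in the sector `t`. -/
def bloch (X : OpBasis dA) (Y : OpBasis dB) (E : SuperOp (Fin dA × Fin dB)) (t : Sector) : ℝ :=
  ∑ p : {p : PairIx dA dB // InSector t p}, ‖liouvilleIn X Y E p.val (none, none)‖ ^ 2

/-- The matrix `𝒮` of sub-unitarities, with rows and columns ordered `A, AB, B`. -/
def subUMatrix (X : OpBasis dA) (Y : OpBasis dB) (E : SuperOp (Fin dA × Fin dB)) :
    Matrix (Fin 3) (Fin 3) ℝ :=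
  !![subU X Y E .A .A,
      1 / √(alpha dB) * subU X Y E .AB .A,
      √(alpha dA / alpha dB) * subU X Y E .B .A;
    √(alpha dB) * subU X Y E .A .AB,
      subU X Y E .AB .AB,
      √(alpha dA) * subU X Y E .B .AB;
    √(alpha dB / alpha dA) * subU X Y E .A .B,
      1 / √(alpha dA) * subU X Y E .AB .B,
      subU X Y E .B .B]

/-- `𝒮` as a complex matrix. -/
def subUMatrixC (X : OpBasis dA) (Y : OpBasis dB) (E : SuperOp (Fin dA × Fin dB)) :
    Matrix (Fin 3) (Fin 3) ℂ :=
  (subUMatrix X Y E).map Complex.ofReal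

/-- The column `(√α_A x_A, √(α_A α_B) x_AB, √α_B x_B)`. -/
def blochColumn (X : OpBasis dA) (Y : OpBasis dB) (E : SuperOp (Fin dA × Fin dB)) :
    Fin 3 → ℝ :=
  ![√(alpha dA) * bloch X Y E .A, √(alpha dA * alpha dB) * bloch X Y E .AB,
    √(alpha dB) * bloch X Y E .B]

/-! ### The invariant vectors of the twirls -/

/-- `|0⟩ = |X_0⟩ ⊗ |X_0⟩` and `|1⟩ = (d² - 1)^{-1/2} ∑_i |X_i⟩ ⊗ |X_i†⟩`. -/
def ket {d : ℕ} (X : OpBasis d) :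
    Fin 2 → (Fin d × Fin d) × (Fin d × Fin d) → ℂ
  | 0 => vecTensor (X.X none) (X.X none)
  | 1 => ((√(alpha d) : ℝ) : ℂ) • ∑ i, vecTensor (X.X (some i)) (X.X (some i))ᴴ

/-- The `A`-part of an index of the two-copy Liouville space of `AB`. -/
def partA {a b : Type*} (p : ((a × b) × (a × b)) × ((a × b) × (a × b))) :
    (a × a) × (a × a) :=
  ((p.1.1.1, p.1.2.1), (p.2.1.1, p.2.2.1))

/-- The `B`-part of an index of the two-copy Liouville space of `AB`. -/
def partB {a b : Type*} (p : ((a × b) × (a × b)) × ((a × b) × (a × b))) :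
    (b × b) × (b × b) :=
  ((p.1.1.2, p.1.2.2), (p.2.1.2, p.2.2.2))

/-- `|ij⟩ = |i⟩_A ⊗ |j⟩_B`, in the tensor order of two copies of `AB`. -/
def ketAB (X : OpBasis dA) (Y : OpBasis dB) (i j : Fin 2) :
    (((Fin dA × Fin dB) × (Fin dA × Fin dB)) × ((Fin dA × Fin dB) × (Fin dA × Fin dB))) → ℂ :=
  fun p => ket X i (partA p) * ket Y j (partB p)

/-- The vectors `|00⟩` and `|10⟩, |11⟩, |01⟩`, in this order. -/
def basisKet (X : OpBasis dA) (Y : OpBasis dB) :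
    Unit ⊕ Fin 3 →
      (((Fin dA × Fin dB) × (Fin dA × Fin dB)) × ((Fin dA × Fin dB) × (Fin dA × Fin dB))) → ℂ
  | .inl _ => ketAB X Y 0 0
  | .inr i => ![ketAB X Y 1 0, ketAB X Y 1 1, ketAB X Y 0 1] i

/-- The operator `P_AB 𝐄^{⊗2} P_AB`. -/
def twirled (E : SuperOp (Fin dA × Fin dB)) :
    Matrix (((Fin dA × Fin dB) × (Fin dA × Fin dB)) × ((Fin dA × Fin dB) × (Fin dA × Fin dB)))
      (((Fin dA × Fin dB) × (Fin dA × Fin dB)) × ((Fin dA × Fin dB) × (Fin dA × Fin dB))) ℂ :=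
  localTwirl (Fin dA) (Fin dB) * liouvilleTwo E * localTwirl (Fin dA) (Fin dB)

end Bipartite

/-- `P` is the orthogonal projector onto the subspace `V`. -/
def IsOrthProj {ι : Type*} [Fintype ι] [DecidableEq ι] (P : Matrix ι ι ℂ)
    (V : Submodule ℂ (ι → ℂ)) : Prop :=
  P * P = P ∧ Pᴴ = P ∧ LinearMap.range (Matrix.toLin' P) = V

/-- `S = Q diag(lam) Q⁻¹` for some invertible complex matrix `Q`. -/
def IsDiagonalizedBy {m : ℕ} (S : Matrix (Fin m) (Fin m) ℂ) (lam : Fin m → ℂ) : Prop :=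
  ∃ Q : Matrix (Fin m) (Fin m) ℂ, IsUnit Q.det ∧ S = Q * Matrix.diagonal lam * Q⁻¹

end LocalTwirl

end

open LocalTwirl

/-! The Haar average of the two-copy conjugation is the orthogonal projector onto its invariant
vectors. These are the vectorized operators commuting with every `U ⊗ U`, which are the combinations
of the identity and the flip (`exists_eq_smul_one_add_smul_flipOp`). In terms of any orthonormal
operator basis, this plane has the orthonormal basis `ket X 0`, `ket X 1` (`twirl_eq_sum_ket`), and
the local twirl is the tensor product of two such projectors, of rank four.

Since `m(s)` is `⟨vec M|vec Ũ_s(ρ)⟩`, its square is a pairing on two copies, and averaging over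
independent gates replaces each gate layer by the local twirl (`sum_vecTensor_noisyCircuit`).
Idempotence of the twirl turns the average into a matrix coefficient of powers of `twirled E`, hence
of powers of a 4 × 4 matrix `R`. Complete positivity makes `E` commute with adjoints, so the entries
of `R` are weighted sums of squared moduli of Liouville entries (`twirled_entry`). Trace
preservation makes the first row `(1, 0, 0, 0)`.

Let `p` annihilate the sub-unitarity matrix. Then `(X - 1) p` annihilates `R`, and the signal
satisfies the corresponding linear recurrence. If 1 is also a root of `p`, this alone would allow an
extra polynomial growth at eigenvalue 1. The signal is however bounded, because states are mapped to
states, so after subtraction of a constant it already satisfies the recurrence of `p`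
(`exists_const_of_bounded`). Solving that recurrence, with `p` the characteristic polynomial or, in
the diagonalizable case, a squarefree polynomial, gives the decay laws. For a separable channel,
each local factor preserves traces and cannot turn a traceless factor into the identity, which kills
four entries of the matrix. -/

namespace LocalTwirl

/-! ### Liouville matrices of conjugations on two copies. -/

section Liouville

variable {n : Type*} [Fintype n] [DecidableEq n]

theorem kronecker_mulVec_mul {l m : Type*} [Fintype l] [Fintype m] (A : Matrix l l ℂ)
    (B : Matrix m m ℂ) (f : l → ℂ) (g : m → ℂ) :
    (A ⊗ₖ B) *ᵥ (fun p => f p.1 * g p.2) = fun p => (A *ᵥ f) p.1 * (B *ᵥ g) p.2 := by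
  ext p
  simp only [mulVec, dotProduct, kroneckerMap_apply, Fintype.sum_prod_type, Finset.sum_mul_sum]
  refine Finset.sum_congr rfl fun i _ => Finset.sum_congr rfl fun j _ => ?_
  ring

theorem liouvilleTwo_mulVec_vecTensor (E : SuperOp n) (Z W : Matrix n n ℂ) :
    liouvilleTwo E *ᵥ vecTensor Z W = vecTensor (E Z) (E W) := by
  have := kronecker_mulVec_mul (liouville E) (liouville E) (vectorize Z) (vectorize W)
  rw [liouville_mulVec_vectorize, liouville_mulVec_vectorize] at this
  exact this

theorem liouville_conjMap (U : Matrix n n ℂ) : liouville (conjMap U) = U ⊗ₖ U.map star := by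
  ext p q
  simp [liouville, vectorize, conjMap, Matrix.mul_apply, Matrix.single_apply, ite_and]

theorem liouvilleTwo_conjMap_mul (U V : Matrix n n ℂ) :
    liouvilleTwo (conjMap (U * V)) = liouvilleTwo (conjMap U) * liouvilleTwo (conjMap V) := by
  have h : (U * V).map star = U.map star * V.map star := by
    ext i j
    simp [Matrix.mul_apply]
  simp only [liouvilleTwo, liouville_conjMap, h, mul_kronecker_mul]

theorem liouvilleTwo_conjMap_conjTranspose (U : Matrix n n ℂ) :
    liouvilleTwo (conjMap Uᴴ) = (liouvilleTwo (conjMap U))ᴴ := by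
  ext p q
  simp [liouvilleTwo, liouville_conjMap]

/-- The twirled action of `U` on an operator on two copies. -/
theorem liouvilleTwo_conjMap_mulVec_vectorizeTwo (U : Matrix n n ℂ)
    (Z : Matrix (n × n) (n × n) ℂ) :
    liouvilleTwo (conjMap U) *ᵥ vectorizeTwo Z = vectorizeTwo ((U ⊗ₖ U) * Z * (U ⊗ₖ U)ᴴ) := by
  ext ⟨⟨i, k⟩, ⟨j, l⟩⟩
  simp only [mulVec, dotProduct, liouvilleTwo, liouville_conjMap, vectorizeTwo,
    kroneckerMap_apply, Fintype.sum_prod_type, Matrix.mul_apply, conjTranspose_apply,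
    Finset.sum_mul, map_apply]
  have (f : n → n → n → n → ℂ) :
      ∑ a, ∑ b, ∑ c, ∑ d, f a b c d = ∑ b, ∑ d, ∑ a, ∑ c, f a b c d := by
    rw [Finset.sum_comm]
    refine Finset.sum_congr rfl fun b _ => ?_
    exact (Finset.sum_congr rfl fun a _ => Finset.sum_comm).trans Finset.sum_comm
  rw [this]
  refine Finset.sum_congr rfl fun a _ => Finset.sum_congr rfl fun b _ =>
    Finset.sum_congr rfl fun c _ => Finset.sum_congr rfl fun d _ => ?_
  simp
  ring

end Liouville

theorem vectorizeTwo_injective {n : Type*} :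
    Function.Injective (vectorizeTwo : Matrix (n × n) (n × n) ℂ → _) := by
  intro Z W h
  ext ⟨i, j⟩ ⟨k, l⟩
  exact congrFun h ((i, k), (j, l))

/-! ### The twirl as an orthogonal projector, from invariance of Haar measure. -/

section Haar

variable {n : Type*} [Fintype n] [DecidableEq n]

instance : (haarU n).IsHaarMeasure := by unfold haarU; infer_instance

instance : IsProbabilityMeasure (haarU n) :=
  ⟨by simpa [haarU] using Measure.haarMeasure_self (K₀ := (⊤ : TopologicalSpace.PositiveCompacts
    (Matrix.unitaryGroup n ℂ)))⟩

theorem continuous_liouvilleTwo_conjMap (p q : (n × n) × (n × n)) :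
    Continuous fun U : Matrix.unitaryGroup n ℂ => liouvilleTwo (conjMap (U : Matrix n n ℂ)) p q := by
  have h (i j : n) : Continuous fun U : Matrix.unitaryGroup n ℂ => (U : Matrix n n ℂ) i j :=
    (continuous_apply_apply i j).comp continuous_subtype_val
  simp only [liouvilleTwo, liouville_conjMap, kroneckerMap_apply, map_apply]
  exact ((h _ _).mul (h _ _).star).mul ((h _ _).mul (h _ _).star)

theorem integrable_of_continuous_haarU {f : Matrix.unitaryGroup n ℂ → ℂ} (hf : Continuous f) :
    Integrable f (haarU n) :=
  hf.integrable_of_hasCompactSupport (HasCompactSupport.of_compactSpace f)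

theorem twirl_apply (p q : (n × n) × (n × n)) :
    twirl n p q = ∫ U, liouvilleTwo (conjMap (U : Matrix n n ℂ)) p q ∂(haarU n) := rfl

theorem liouvilleTwo_mul_twirl (V : Matrix.unitaryGroup n ℂ) :
    liouvilleTwo (conjMap (V : Matrix n n ℂ)) * twirl n = twirl n := by
  ext p q
  have h := integral_mul_left_eq_self (μ := haarU n)
    (fun U : Matrix.unitaryGroup n ℂ => liouvilleTwo (conjMap (U : Matrix n n ℂ)) p q) V
  rw [twirl_apply, ← h]
  simp only [UnitaryGroup.mul_val, liouvilleTwo_conjMap_mul, Matrix.mul_apply, twirl_apply]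
  rw [integral_finsetSum]
  · simp only [integral_const_mul]
  · intro r _
    exact (integrable_of_continuous_haarU (continuous_liouvilleTwo_conjMap r q)).const_mul _

/-- Adjoint of left invariance at `V⁻¹`, so right invariance of the Haar measure is not needed. -/
theorem twirl_conjTranspose_mul_liouvilleTwo (V : Matrix.unitaryGroup n ℂ) :
    (twirl n)ᴴ * liouvilleTwo (conjMap (V : Matrix n n ℂ)) = (twirl n)ᴴ := by
  have h := congrArg conjTranspose (liouvilleTwo_mul_twirl V⁻¹)
  rw [conjTranspose_mul, ← liouvilleTwo_conjMap_conjTranspose] at h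
  simpa [star_eq_conjTranspose] using h

/-- Integrating the previous identity over `V` gives this one. Its left side is self-adjoint, hence
so is the twirl, and idempotence follows. -/
theorem twirl_conjTranspose_mul_self : (twirl n)ᴴ * twirl n = (twirl n)ᴴ := by
  ext p q
  simp only [Matrix.mul_apply, twirl_apply]
  simp only [← integral_const_mul]
  rw [← integral_finsetSum]
  · simp only [← Matrix.mul_apply, twirl_conjTranspose_mul_liouvilleTwo]
    simp
  · intro r _
    exact (integrable_of_continuous_haarU (continuous_liouvilleTwo_conjMap r q)).const_mul _

theorem twirl_isHermitian : (twirl n)ᴴ = twirl n := by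
  have h := congrArg conjTranspose (twirl_conjTranspose_mul_self (n := n))
  rw [conjTranspose_mul, conjTranspose_conjTranspose, twirl_conjTranspose_mul_self] at h
  exact h

theorem twirl_mul_self : twirl n * twirl n = twirl n := by
  simpa [twirl_isHermitian] using twirl_conjTranspose_mul_self (n := n)

theorem twirl_mulVec_of_invariant {w : (n × n) × (n × n) → ℂ}
    (hw : ∀ U : Matrix.unitaryGroup n ℂ, liouvilleTwo (conjMap (U : Matrix n n ℂ)) *ᵥ w = w) :
    twirl n *ᵥ w = w := by
  ext p
  simp only [mulVec, dotProduct, twirl_apply]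
  simp only [← integral_mul_const]
  rw [← integral_finsetSum]
  · have (U : Matrix.unitaryGroup n ℂ) :
        ∑ i, liouvilleTwo (conjMap (U : Matrix n n ℂ)) p i * w i = w p := congrFun (hw U) p
    simp [this]
  · intro r _
    exact (integrable_of_continuous_haarU (continuous_liouvilleTwo_conjMap p r)).mul_const _

theorem liouvilleTwo_conjMap_kronecker {a b : Type*} [Fintype a] [DecidableEq a] [Fintype b]
    [DecidableEq b] (U : Matrix a a ℂ) (V : Matrix b b ℂ)
    (p q : ((a × b) × (a × b)) × ((a × b) × (a × b))) :
    liouvilleTwo (conjMap (U ⊗ₖ V)) p q =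
      liouvilleTwo (conjMap U) (partA p) (partA q) *
        liouvilleTwo (conjMap V) (partB p) (partB q) := by
  simp only [liouvilleTwo, liouville_conjMap, kroneckerMap_apply, map_apply, partA, partB,
    star_mul']
  ring

theorem localTwirl_apply {a b : Type*} [Fintype a] [DecidableEq a] [Fintype b]
    [DecidableEq b] (p q : ((a × b) × (a × b)) × ((a × b) × (a × b))) :
    localTwirl a b p q = twirl a (partA p) (partA q) * twirl b (partB p) (partB q) := by
  simp only [localTwirl, twirl_apply, Matrix.of_apply, liouvilleTwo_conjMap_kronecker,
    integral_const_mul, integral_mul_const]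

end Haar

/-! ### The commutant of all `U ⊗ U`. -/

section Commutant

variable {n : Type*} [Fintype n] [DecidableEq n]

/-- `A ⊗ 1 + 1 ⊗ A`. -/
def kroneckerSum (A : Matrix n n ℂ) : Matrix (n × n) (n × n) ℂ := A ⊗ₖ 1 + 1 ⊗ₖ A

theorem Commute.kroneckerSum_add {Z : Matrix (n × n) (n × n) ℂ} {A B : Matrix n n ℂ}
    (hA : Commute Z (kroneckerSum A)) (hB : Commute Z (kroneckerSum B)) :
    Commute Z (kroneckerSum (A + B)) := by
  have : kroneckerSum (A + B) = kroneckerSum A + kroneckerSum B := by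
    simp only [kroneckerSum, add_kronecker, kronecker_add]; abel
  rw [this]
  exact hA.add_right hB

theorem Commute.kroneckerSum_smul {Z : Matrix (n × n) (n × n) ℂ} {A : Matrix n n ℂ} (c : ℂ)
    (hA : Commute Z (kroneckerSum A)) : Commute Z (kroneckerSum (c • A)) := by
  have : kroneckerSum (c • A) = c • kroneckerSum A := by
    simp only [kroneckerSum, smul_kronecker, kronecker_smul, smul_add]
  rw [this]
  exact hA.smul_right c

theorem one_add_smul_mem_unitaryGroup {P : Matrix n n ℂ} (hP : Pᴴ = P) (hPP : P * P = P) {t : ℂ}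
    (ht : t + star t + t * star t = 0) : 1 + t • P ∈ unitaryGroup n ℂ := by
  rw [mem_unitaryGroup_iff, star_eq_conjTranspose, conjTranspose_add, conjTranspose_one,
    conjTranspose_smul, hP]
  have : (1 + t • P) * (1 + star t • P) = 1 + (t + star t + t * star t) • P := by
    simp only [add_mul, mul_add, one_mul, mul_one, smul_mul_smul_comm, hPP, add_smul]
    abel
  rw [this, ht, zero_smul, add_zero]

/-- For a projection `P`, `1 + tP` is unitary as soon as `|1 + t| = 1`. Its tensor square is
quadratic in `t`, so two values of `t` isolate the linear term; this replaces differentiation along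
one-parameter groups. -/
theorem commute_kroneckerSum_of_isProj {Z : Matrix (n × n) (n × n) ℂ}
    (hZ : ∀ U ∈ unitaryGroup n ℂ, Commute Z (U ⊗ₖ U)) {P : Matrix n n ℂ} (hP : Pᴴ = P)
    (hPP : P * P = P) : Commute Z (kroneckerSum P) := by
  have key : ∀ t : ℂ, t + star t + t * star t = 0 →
      Commute Z (t • kroneckerSum P + t ^ 2 • (P ⊗ₖ P)) := by
    intro t ht
    have h := (hZ _ (one_add_smul_mem_unitaryGroup hP hPP ht)).sub_right (Commute.one_right Z)
    have e : (1 + t • P) ⊗ₖ (1 + t • P) - 1 = t • kroneckerSum P + t ^ 2 • (P ⊗ₖ P) := by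
      simp only [kroneckerSum, add_kronecker, kronecker_add, smul_kronecker, kronecker_smul,
        one_kronecker_one, smul_add, smul_smul, pow_two]
      abel
    rwa [e] at h
  -- The two values are `1 + t = -1` and `1 + t = i`; the combination `h₃` cancels the coefficients
  -- of `P ⊗ P` and normalizes the linear one to 1.
  have h₁ := key (-2) (by norm_num)
  have h₂ := key (Complex.I - 1) (by
    simp [Complex.ext_iff])
  have h₃ := ((h₁.smul_right (-(Complex.I - 1) / 2)).add_right
    (h₂.smul_right (2 / (Complex.I - 1)))).smul_right (1 / (Complex.I + 1))
  have hI : Complex.I - 1 ≠ 0 := by simp [Complex.ext_iff]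
  have hI' : Complex.I + 1 ≠ 0 := by simp [Complex.ext_iff]
  refine (?_ : _ = kroneckerSum P) ▸ h₃
  simp only [smul_add, smul_smul]
  rw [add_add_add_comm, ← add_smul, ← add_smul]
  have e₁ : 1 / (Complex.I + 1) * (-(Complex.I - 1) / 2 * -2) +
      1 / (Complex.I + 1) * (2 / (Complex.I - 1) * (Complex.I - 1)) = 1 := by
    field_simp; ring
  have e₂ : 1 / (Complex.I + 1) * (-(Complex.I - 1) / 2 * (-2) ^ 2) +
      1 / (Complex.I + 1) * (2 / (Complex.I - 1) * (Complex.I - 1) ^ 2) = 0 := by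
    field_simp; ring
  rw [e₁, e₂, one_smul, zero_smul, add_zero]

theorem commute_kroneckerSum_single {Z : Matrix (n × n) (n × n) ℂ}
    (hZ : ∀ U ∈ unitaryGroup n ℂ, Commute Z (U ⊗ₖ U)) (a b : n) :
    Commute Z (kroneckerSum (Matrix.single a b 1)) := by
  have hdiag (a : n) : Commute Z (kroneckerSum (Matrix.single a a 1)) :=
    commute_kroneckerSum_of_isProj hZ (by simp) (by simp)
  by_cases hab : a = b
  · subst hab; exact hdiag a
  -- The matrix is the rank-one projection `P_z` onto the line of `e_a + z e_b`.
  have hoff (z : ℂ) (hz : z * star z = 1) : Commute Z (kroneckerSum ((1 / 2 : ℂ) •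
      (Matrix.single a a 1 + Matrix.single b b 1 + star z • Matrix.single a b 1 +
        z • Matrix.single b a 1))) := by
    refine commute_kroneckerSum_of_isProj hZ ?_ ?_
    · simp only [conjTranspose_smul, conjTranspose_add, conjTranspose_single, star_one, star_star]
      rw [show star (1 / 2 : ℂ) = 1 / 2 by simp]
      congr 1
      abel
    · have hba : b ≠ a := fun h => hab h.symm
      simp only [mul_add, add_mul, single_mul_single_same, mul_one, ne_eq,
        hab, hba, not_false_eq_true, single_mul_single_of_ne, smul_mul_assoc, mul_smul_comm,
        smul_zero, add_zero, zero_add]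
      match_scalars <;> first | ring1 | linear_combination (1 / 4 : ℂ) * hz
  -- Polarization: `E_ab = P_1 + i P_i - (1 + i)/2 (E_aa + E_bb)`.
  have h := ((hoff 1 (by simp)).kroneckerSum_add ((hoff Complex.I (by simp)).kroneckerSum_smul
    Complex.I)).kroneckerSum_add (((hdiag a).kroneckerSum_add (hdiag b)).kroneckerSum_smul
      (-((1 + Complex.I) / 2)))
  convert h using 2
  simp only [star_one, one_smul, smul_add, smul_smul, Complex.star_def, Complex.conj_I]
  have hII : Complex.I * (1 / 2 * -Complex.I) = 1 / 2 := by
    linear_combination (-1 / 2 : ℂ) * Complex.I_mul_I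
  have hII' : Complex.I * (1 / 2 * Complex.I) = -1 / 2 := by
    linear_combination (1 / 2 : ℂ) * Complex.I_mul_I
  rw [hII, hII']
  module

theorem entry_relation {Z : Matrix (n × n) (n × n) ℂ}
    (hZ : ∀ U ∈ unitaryGroup n ℂ, Commute Z (U ⊗ₖ U)) (a b i j k l : n) :
    (if a = i then Z (b, j) (k, l) else 0) + (if a = j then Z (i, b) (k, l) else 0) =
      (if b = k then Z (i, j) (a, l) else 0) + (if b = l then Z (i, j) (k, a) else 0) := by
  have h := congrFun (congrFun (commute_kroneckerSum_single hZ a b).eq (i, j)) (k, l)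
  simp only [kroneckerSum, Matrix.mul_apply, Matrix.add_apply, kroneckerMap_apply,
    Fintype.sum_prod_type, Matrix.single_apply, Matrix.one_apply, mul_add, add_mul,
    Finset.sum_add_distrib] at h
  simp [ite_and, Finset.sum_ite_eq, Finset.sum_ite_eq'] at h
  exact h.symm

-- Symmetry lets the transport in the first index act on the second as well, so any ordered pair of
-- distinct indices reaches any other. With only two indices, symmetry alone suffices.
omit [Fintype n] in
theorem eq_of_symm_of_transport {b : n → n → ℂ} (hs : ∀ i j, i ≠ j → b i j = b j i)
    (ht : ∀ i j m, i ≠ j → m ≠ j → b i j = b m j) {i j x y : n} (hij : i ≠ j) (hxy : x ≠ y) :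
    b i j = b x y := by
  by_cases h : x = j
  · subst h
    rw [ht i x y hij hxy.symm, hs y x hxy.symm]
  · rw [ht i j x hij h, hs x j h, ht j x y (Ne.symm h) hxy.symm, hs y x hxy.symm]

/-- Operators commuting with all `U ⊗ U` are linear combinations of `1` and the flip. -/
theorem exists_eq_smul_one_add_smul_flipOp [Nontrivial n] {Z : Matrix (n × n) (n × n) ℂ}
    (hZ : ∀ U ∈ unitaryGroup n ℂ, Commute Z (U ⊗ₖ U)) :
    ∃ β γ : ℂ, Z = β • 1 + γ • flipOp n := by
  have R := entry_relation hZ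
  obtain ⟨x, y, hxy⟩ := exists_pair_ne n
  -- Off-diagonal matrix units relate the surviving entries. Comparing `hd` with `hd'` gives the
  -- symmetry of the coefficients of the identity and of the flip; three-index relations then give
  -- the transport.
  have hd : ∀ i j, i ≠ j → Z (j, j) (j, j) = Z (i, j) (i, j) + Z (i, j) (j, i) := by
    intro i j h
    have := R i j i j j j
    simpa [h] using this
  have hd' : ∀ i j, i ≠ j → Z (i, i) (i, i) = Z (i, j) (i, j) + Z (j, i) (i, j) := by
    intro i j h
    have := R i j i i i j
    simp only [h.symm, if_true, if_false, zero_add] at this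
    rw [← this, add_comm]
  have hbs : ∀ i j, i ≠ j → Z (i, j) (i, j) = Z (j, i) (j, i) := by
    intro i j h
    have h₁ := hd' i j h
    rw [hd j i h.symm] at h₁
    exact (add_right_cancel h₁).symm
  have hcs : ∀ i j, i ≠ j → Z (i, j) (j, i) = Z (j, i) (i, j) := by
    intro i j h
    have h₁ := R i j j i j j
    simp only [h, if_true, if_false, zero_add] at h₁
    rw [hd i j h, hbs i j h, add_comm] at h₁
    exact add_right_cancel h₁
  have hbt : ∀ i j m, i ≠ j → m ≠ j → Z (i, j) (i, j) = Z (m, j) (m, j) := by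
    intro i j m h h'
    have := R i m i j m j
    simpa [h, h', eq_comm] using this
  have hct : ∀ i j m, i ≠ j → m ≠ j → Z (i, j) (j, i) = Z (m, j) (j, m) := by
    intro i j m h h'
    have := R i m i j j m
    simpa [h, h', eq_comm] using this
  have hb : ∀ i j, i ≠ j → Z (i, j) (i, j) = Z (x, y) (x, y) := fun i j h =>
    eq_of_symm_of_transport (b := fun i j => Z (i, j) (i, j)) hbs hbt h hxy
  have hc : ∀ i j, i ≠ j → Z (i, j) (j, i) = Z (x, y) (y, x) := fun i j h =>
    eq_of_symm_of_transport (b := fun i j => Z (i, j) (j, i)) hcs hct h hxy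
  refine ⟨Z (x, y) (x, y), Z (x, y) (y, x), ?_⟩
  ext ⟨i, j⟩ ⟨k, l⟩
  -- Weight argument: diagonal matrix units force an entry to vanish unless `{i, j} = {k, l}` as
  -- multisets.
  have hz : ∀ a, ((if a = i then 1 else 0) + (if a = j then 1 else 0) - (if a = k then 1 else 0) -
      (if a = l then 1 else 0) : ℂ) * Z (i, j) (k, l) = 0 := by
    intro a
    have := R a a i j k l
    split_ifs at this ⊢ <;> subst_vars <;> linear_combination this
  have hzi := hz i
  have hzj := hz j
  by_cases hij : i = j
  · subst hij
    obtain ⟨m, hm⟩ := exists_ne i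
    have h := hd m i hm
    rw [hb m i hm, hc m i hm] at h
    by_cases hk : i = k
    · subst hk
      by_cases hl : i = l
      · subst hl
        simp [flipOp, h]
      · norm_num [hl] at hzi
        simp [flipOp, hl, hzi]
    · by_cases hl : i = l
      · subst hl
        norm_num [hk] at hzi
        simp [flipOp, hk, hzi]
      · norm_num [hk, hl] at hzi
        simp [flipOp, hk, hl, hzi]
  · have hji : j ≠ i := Ne.symm hij
    have h₁ := hb i j hij
    have h₂ := hc i j hij
    by_cases hki : i = k
    · subst hki
      by_cases hlj : j = l
      · subst hlj
        simp [flipOp, hij, h₁]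
      · simp [hji, hlj] at hzj
        simp [flipOp, hji, hlj, hzj]
    · by_cases hkj : j = k
      · subst hkj
        by_cases hli : i = l
        · subst hli
          simp [flipOp, hij, h₂]
        · simp [hij, hli] at hzi
          simp [flipOp, hij, hli, hzi]
      · by_cases hlj : j = l
        · subst hlj
          simp [hij, hki] at hzi
          simp [flipOp, hki, hkj, hzi]
        · simp [hji, hkj, hlj] at hzj
          simp [flipOp, hki, hkj, hzj]

/-- The twirl is the orthogonal projector onto the span of the identity and the flip. -/
theorem isOrthProj_twirl [Nontrivial n] :
    IsOrthProj (twirl n) (Submodule.span ℂ {vectorizeTwo 1, vectorizeTwo (flipOp n)}) := by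
  refine ⟨twirl_mul_self, twirl_isHermitian, le_antisymm ?_ ?_⟩
  · rintro _ ⟨v, rfl⟩
    rw [toLin'_apply]
    set w := twirl n *ᵥ v with hw
    -- Undoing the vectorization turns invariance of a vector in the range into commutation of `Z`
    -- with `U ⊗ U`.
    let Z : Matrix (n × n) (n × n) ℂ := Matrix.of fun p q => w ((p.1, q.1), (p.2, q.2))
    have hZw : vectorizeTwo Z = w := rfl
    have hZ : ∀ U ∈ unitaryGroup n ℂ, Commute Z (U ⊗ₖ U) := by
      intro U hU
      have h : liouvilleTwo (conjMap U) *ᵥ vectorizeTwo Z = vectorizeTwo Z := by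
        rw [hZw, hw, mulVec_mulVec, liouvilleTwo_mul_twirl ⟨U, hU⟩]
      rw [liouvilleTwo_conjMap_mulVec_vectorizeTwo] at h
      have h' := vectorizeTwo_injective h
      have hUU : (U ⊗ₖ U)ᴴ * (U ⊗ₖ U) = 1 := by
        rw [conjTranspose_kronecker, ← mul_kronecker_mul, ← star_eq_conjTranspose,
          mem_unitaryGroup_iff'.mp hU, one_kronecker_one]
      rw [Commute, SemiconjBy]
      nth_rw 1 [← h']
      rw [Matrix.mul_assoc, hUU, Matrix.mul_one]
    obtain ⟨β, γ, h⟩ := exists_eq_smul_one_add_smul_flipOp hZ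
    rw [Submodule.mem_span_pair]
    refine ⟨β, γ, ?_⟩
    rw [← hZw, h]
    rfl
  · rw [Submodule.span_le]
    have hfix (Z : Matrix (n × n) (n × n) ℂ)
        (hZ : ∀ U ∈ unitaryGroup n ℂ, (U ⊗ₖ U) * Z = Z * (U ⊗ₖ U)) :
        vectorizeTwo Z ∈ LinearMap.range (toLin' (twirl n)) := by
      refine ⟨vectorizeTwo Z, ?_⟩
      rw [toLin'_apply]
      refine twirl_mulVec_of_invariant fun U => ?_
      have hUU : ((U : Matrix n n ℂ) ⊗ₖ (U : Matrix n n ℂ)) * ((U : Matrix n n ℂ) ⊗ₖ (U : Matrix n n ℂ))ᴴ = 1 := by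
        rw [conjTranspose_kronecker, ← mul_kronecker_mul, ← star_eq_conjTranspose,
          mem_unitaryGroup_iff.mp U.2, one_kronecker_one]
      rw [liouvilleTwo_conjMap_mulVec_vectorizeTwo, hZ _ U.2, Matrix.mul_assoc, hUU,
        Matrix.mul_one]
    rintro _ (rfl | rfl)
    · exact hfix _ fun U _ => by rw [Matrix.mul_one, Matrix.one_mul]
    · refine hfix _ fun U _ => ?_
      ext ⟨i, j⟩ ⟨k, l⟩
      simp [Matrix.mul_apply, flipOp, Fintype.sum_prod_type, ite_and, mul_comm]

end Commutant

/-! ### Linear recurrences as polynomials in the shift operator. -/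

section Recurrence

open Polynomial

/-- The left shift of sequences. -/
def seqShift : Module.End ℂ (ℕ → ℂ) := LinearMap.funLeft ℂ ℂ Nat.succ

theorem seqShift_apply (f : ℕ → ℂ) (n : ℕ) : seqShift f n = f (n + 1) := rfl

theorem aeval_seqShift_X_sub_C (z : ℂ) (f : ℕ → ℂ) (n : ℕ) :
    aeval seqShift (X - C z) f n = f (n + 1) - z * f n := by
  simp [seqShift_apply, Algebra.algebraMap_eq_smul_one]

theorem aeval_mul_end_apply (p q : ℂ[X]) (f : ℕ → ℂ) :
    aeval seqShift (p * q) f = aeval seqShift p (aeval seqShift q f) := by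
  rw [map_mul]; rfl

theorem aeval_seqShift_const (p : ℂ[X]) (c : ℂ) :
    aeval seqShift p (fun _ => c) = fun _ => p.eval 1 * c := by
  induction p using Polynomial.induction_on' with
  | add p q hp hq => 
    rw [map_add, LinearMap.add_apply, hp, hq]
    ext; simp [add_mul]
  | monomial n a =>
    have : ∀ n, (seqShift ^ n) (fun _ => c) = fun _ => c := by
      intro n
      induction n with
      | zero => rfl
      | succ n ih => rw [pow_succ, Module.End.mul_apply, show seqShift (fun _ => c) = fun _ => c from rfl, ih]
    rw [aeval_monomial, Module.End.mul_apply, this, Module.algebraMap_end_apply]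
    ext; simp

theorem aeval_seqShift_bounded (p : ℂ[X]) {f : ℕ → ℂ} {B : ℝ} (hf : ∀ n, ‖f n‖ ≤ B) :
    ∃ B', ∀ n, ‖aeval seqShift p f n‖ ≤ B' := by
  induction p using Polynomial.induction_on' with
  | add p q hp hq =>
    obtain ⟨b, hb⟩ := hp
    obtain ⟨c, hc⟩ := hq
    refine ⟨b + c, fun n => ?_⟩
    rw [map_add]
    exact (norm_add_le _ _).trans (add_le_add (hb n) (hc n))
  | monomial m a =>
    have : ∀ m n, (seqShift ^ m) f n = f (n + m) := by
      intro m
      induction m with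
      | zero => intro n; rfl
      | succ m ih => intro n; rw [pow_succ', Module.End.mul_apply, seqShift_apply, ih]; congr 1; ring
    refine ⟨‖a‖ * B, fun n => ?_⟩
    rw [aeval_monomial, Module.End.mul_apply, Module.algebraMap_end_apply, Pi.smul_apply, this,
      norm_smul]
    gcongr
    exact hf _

/-- A bounded sequence annihilated by `(S - 1) p(S)` is, up to a constant, annihilated by
`p(S)`. -/
theorem exists_const_of_bounded (p : ℂ[X]) {f : ℕ → ℂ} {B : ℝ} (hf : ∀ n, ‖f n‖ ≤ B)
    (h : aeval seqShift ((X - C 1) * p) f = 0) :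
    ∃ c : ℂ, aeval seqShift p (f - fun _ => c) = 0 := by
  -- Being killed by `S - 1` means that `p(S) f` is a constant `h₀`. If `p(1) ≠ 0`, subtracting the
  -- constant `h₀ / p(1)` from `f` removes it.
  have hconst : ∀ n, aeval seqShift p f n = aeval seqShift p f 0 := by
    intro n
    induction n with
    | zero => rfl
    | succ n ih =>
      have := congrFun h n
      rw [aeval_mul_end_apply, aeval_seqShift_X_sub_C, one_mul, Pi.zero_apply, sub_eq_zero] at this
      rw [this, ih]
  set h₀ := aeval seqShift p f 0 with hh₀
  by_cases hp : p.eval 1 = 0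
  · obtain ⟨r, rfl⟩ := dvd_iff_isRoot.mpr hp
    obtain ⟨B', hB'⟩ := aeval_seqShift_bounded r hf
    set g := aeval seqShift r f with hg
    -- Here `p = (X - 1) r`, and `g = r(S) f` has constant increment `h₀`. It is bounded along with
    -- `f`, so `h₀ = 0` and no correction is needed.
    have hlin : ∀ n : ℕ, g n = g 0 + n * h₀ := by
      intro n
      induction n with
      | zero => simp
      | succ n ih =>
        have := hconst n
        rw [aeval_mul_end_apply, aeval_seqShift_X_sub_C, one_mul, ← hg, sub_eq_iff_eq_add] at this
        rw [this, ih]; push_cast; ring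
    have h0 : h₀ = 0 := by
      by_contra hne
      obtain ⟨n, hn⟩ := exists_nat_gt (2 * B' / ‖h₀‖)
      rw [div_lt_iff₀ (norm_pos_iff.mpr hne)] at hn
      have : ‖(n : ℂ) * h₀‖ ≤ 2 * B' := by
        rw [show (n : ℂ) * h₀ = g n - g 0 by rw [hlin n]; ring]
        exact (norm_sub_le _ _).trans (by linarith [hB' n, hB' 0])
      rw [norm_mul, Complex.norm_natCast] at this
      linarith
    refine ⟨0, ?_⟩
    ext n
    rw [show (f - fun _ => (0 : ℂ)) = f by ext; simp, hconst n, h0]; rfl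
  · refine ⟨h₀ / p.eval 1, ?_⟩
    ext n
    rw [map_sub, Pi.sub_apply, aeval_seqShift_const, hconst n]
    field_simp
    simp

/-- The sequences `n ↦ binom(n, j) z^(n-j)` form a Jordan chain: `S - z` lowers `j` by one. The
binomial factor vanishes where the truncated exponent would be wrong. -/
theorem choose_pow_shift (z : ℂ) (j n : ℕ) :
    ((n + 1).choose (j + 1) : ℂ) * z ^ (n + 1 - (j + 1)) -
      z * ((n.choose (j + 1) : ℂ) * z ^ (n - (j + 1))) = (n.choose j : ℂ) * z ^ (n - j) := by
  rw [Nat.choose_succ_succ, Nat.add_sub_add_right]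
  by_cases h : j + 1 ≤ n
  · obtain ⟨d, rfl⟩ := Nat.exists_eq_add_of_le h
    rw [show j + 1 + d - j = d + 1 by omega, show j + 1 + d - (j + 1) = d by omega]
    push_cast; ring
  · rw [Nat.choose_eq_zero_of_lt (by omega : n < j + 1)]
    simp

theorem eq_sum_of_aeval_pow (z : ℂ) (m : ℕ) (f : ℕ → ℂ)
    (h : aeval seqShift ((X - C z) ^ m) f = 0) :
    ∃ c : ℕ → ℂ, ∀ n, f n = ∑ j ∈ Finset.range m, c j * (n.choose j : ℂ) * z ^ (n - j) := by
  induction m generalizing f with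
  | zero => exact ⟨0, fun n => by simpa using congrFun h n⟩
  | succ m ih =>
    rw [pow_succ, aeval_mul_end_apply] at h
    obtain ⟨c, hc⟩ := ih _ h
    simp only [aeval_seqShift_X_sub_C] at hc
    have key : ∀ n, f n = f 0 * z ^ n +
        ∑ j ∈ Finset.range m, c j * ((n.choose (j + 1) : ℂ) * z ^ (n - (j + 1))) := by
      intro n
      induction n with
      | zero => simp
      | succ n ihn =>
        have hs : ∑ j ∈ Finset.range m,
              c j * (((n + 1).choose (j + 1) : ℂ) * z ^ (n + 1 - (j + 1))) =
            ∑ j ∈ Finset.range m, c j * (n.choose j : ℂ) * z ^ (n - j) +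
              z * ∑ j ∈ Finset.range m, c j * ((n.choose (j + 1) : ℂ) * z ^ (n - (j + 1))) := by
          rw [Finset.mul_sum, ← Finset.sum_add_distrib]
          refine Finset.sum_congr rfl fun j _ => ?_
          rw [mul_assoc (c j), ← choose_pow_shift z j n, mul_sub, mul_left_comm z (c j),
            sub_add_cancel]
        rw [sub_eq_iff_eq_add.mp (hc n), hs, ihn]
        ring
    -- Inverting `S - z` shifts the coefficients up by one; the free initial value `f 0` becomes the
    -- coefficient at `j = 0`.
    refine ⟨fun j => Nat.casesOn j (f 0) c, fun n => ?_⟩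
    rw [Finset.sum_range_succ', key n]
    simp [mul_assoc, add_comm]

/-- Primary decomposition: the kernel of a product of coprime polynomials in the shift is the sum of
the kernels. -/
theorem eq_sum_of_aeval_prod (s : Finset ℂ) (m : ℂ → ℕ) (f : ℕ → ℂ)
    (h : aeval seqShift (∏ z ∈ s, (X - C z) ^ m z) f = 0) :
    ∃ c : ℂ → ℕ → ℂ, ∀ n, f n =
      ∑ z ∈ s, ∑ j ∈ Finset.range (m z), c z j * (n.choose j : ℂ) * z ^ (n - j) := by
  classical
  induction s using Finset.induction_on generalizing f with
  | empty => exact ⟨0, fun n => by simpa using congrFun h n⟩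
  | insert a s ha ih =>
    rw [Finset.prod_insert ha] at h
    have hco : IsCoprime ((X - C a) ^ m a) (∏ z ∈ s, (X - C z) ^ m z) :=
      IsCoprime.prod_right fun z hz =>
        (isCoprime_X_sub_C_of_isUnit_sub (sub_ne_zero.mpr
          (fun h => ha (by rwa [h]))).isUnit).pow
    have hmem : f ∈ LinearMap.ker (aeval seqShift ((X - C a) ^ m a * ∏ z ∈ s, (X - C z) ^ m z)) := h
    rw [← sup_ker_aeval_eq_ker_aeval_mul_of_coprime _ hco, Submodule.mem_sup] at hmem
    obtain ⟨f₁, h₁, f₂, h₂, rfl⟩ := hmem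
    obtain ⟨c₁, hc₁⟩ := eq_sum_of_aeval_pow a (m a) f₁ h₁
    obtain ⟨c₂, hc₂⟩ := ih f₂ h₂
    refine ⟨Function.update c₂ a c₁, fun n => ?_⟩
    rw [Finset.sum_insert ha, Pi.add_apply, hc₁, hc₂, Function.update_self]
    congr 1
    refine Finset.sum_congr rfl fun z hz => ?_
    rw [Function.update_of_ne (fun h => ha (by rwa [← h]))]

theorem eq_sum_of_aeval_monic {p : ℂ[X]} (hp : p.Monic) (f : ℕ → ℂ)
    (h : aeval seqShift p f = 0) :
    ∃ c : ℂ → ℕ → ℂ, ∀ n, f n = ∑ z ∈ p.roots.toFinset,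
      ∑ j ∈ Finset.range (p.roots.count z), c z j * (n.choose j : ℂ) * z ^ (n - j) := by
  refine eq_sum_of_aeval_prod _ _ _ ?_
  have := (IsAlgClosed.splits p).eq_prod_roots_of_monic hp
  rw [Finset.prod_multiset_map_count] at this
  rwa [← this]

theorem eq_sum_of_aeval_squarefree {ι : Type*} [Fintype ι] (lam : ι → ℂ) (f : ℕ → ℂ)
    (h : aeval seqShift (∏ z ∈ Finset.univ.image lam, (X - C z)) f = 0) :
    ∃ c : ι → ℂ, ∀ n, f n = ∑ i, c i * lam i ^ n := by
  classical
  obtain ⟨c, hc⟩ := eq_sum_of_aeval_prod (Finset.univ.image lam) (fun _ => 1) f (by simpa using h)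
  -- The family `lam` may repeat values, so each coefficient is shared equally among the indices
  -- carrying the same value.
  refine ⟨fun i => c (lam i) 0 / ({j ∈ Finset.univ | lam j = lam i} : Finset ι).card, fun n => ?_⟩
  rw [hc, ← Finset.sum_fiberwise_of_maps_to (s := Finset.univ) (t := Finset.univ.image lam)
    (g := lam) (fun i _ => Finset.mem_image_of_mem _ (Finset.mem_univ i))]
  refine Finset.sum_congr rfl fun z hz => ?_
  have hfib : ∀ i ∈ ({j ∈ Finset.univ | lam j = z} : Finset ι),
      c (lam i) 0 / ({j ∈ Finset.univ | lam j = lam i} : Finset ι).card * lam i ^ n =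
        c z 0 / ({j ∈ Finset.univ | lam j = z} : Finset ι).card * z ^ n := by
    intro i hi
    have hi' : lam i = z := (Finset.mem_filter.mp hi).2
    rw [hi']
  rw [Finset.sum_congr rfl hfib, Finset.sum_const]
  obtain ⟨i, -, hi⟩ := Finset.mem_image.mp hz
  have : (({j ∈ Finset.univ | lam j = z} : Finset ι).card : ℂ) ≠ 0 := by
    rw [Nat.cast_ne_zero, Finset.card_ne_zero]
    exact ⟨i, by simp [hi]⟩
  rw [nsmul_eq_mul]
  field_simp
  simp

/-- Shifting a matrix coefficient of `R ^ n` multiplies by `R`, so annihilating polynomials of `R`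
become recurrences. -/
theorem aeval_seqShift_matrix {ι : Type*} [Fintype ι] [DecidableEq ι] (R A : Matrix ι ι ℂ)
    (u w : ι → ℂ) (p : ℂ[X]) :
    aeval seqShift p (fun n => u ⬝ᵥ ((A * R ^ n) *ᵥ w)) =
      fun n => u ⬝ᵥ ((A * aeval R p * R ^ n) *ᵥ w) := by
  induction p using Polynomial.induction_on' with
  | add p q hp hq =>
    rw [map_add, LinearMap.add_apply, hp, hq]
    ext n
    simp [mul_add, add_mul, add_mulVec, dotProduct_add]
  | monomial m a =>
    have : ∀ m n, (seqShift ^ m) (fun n => u ⬝ᵥ ((A * R ^ n) *ᵥ w)) n =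
        u ⬝ᵥ ((A * R ^ (n + m)) *ᵥ w) := by
      intro m
      induction m with
      | zero => intro n; rfl
      | succ m ih =>
        intro n
        rw [pow_succ', Module.End.mul_apply, seqShift_apply, ih, add_assoc, add_comm 1]
    ext n
    rw [aeval_monomial, Module.End.mul_apply, Module.algebraMap_end_apply, Pi.smul_apply, this,
      aeval_monomial, add_comm n m, pow_add, Algebra.algebraMap_eq_smul_one]
    simp [mul_assoc, smul_mulVec]

theorem aeval_fromBlocks_lower {ι κ : Type*} [Fintype ι] [DecidableEq ι] [Fintype κ]
    [DecidableEq κ] (A : Matrix ι ι ℂ) (x : Matrix κ ι ℂ) (S : Matrix κ κ ℂ) (p : ℂ[X]) :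
    ∃ y : Matrix κ ι ℂ, aeval (fromBlocks A 0 x S) p = fromBlocks (aeval A p) 0 y (aeval S p) := by
  induction p using Polynomial.induction_on' with
  | add p q hp hq =>
    obtain ⟨y, hy⟩ := hp
    obtain ⟨y', hy'⟩ := hq
    exact ⟨y + y', by simp [hy, hy', fromBlocks_add]⟩
  | monomial m a =>
    have : ∀ m, ∃ y : Matrix κ ι ℂ, (fromBlocks A 0 x S) ^ m = fromBlocks (A ^ m) 0 y (S ^ m) := by
      intro m
      induction m with
      | zero => exact ⟨0, by simp⟩
      | succ m ih =>
        obtain ⟨y, hy⟩ := ih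
        exact ⟨y * A + S ^ m * x, by simp [pow_succ, hy, fromBlocks_multiply]⟩
    obtain ⟨y, hy⟩ := this m
    refine ⟨a • y, ?_⟩
    simp [aeval_monomial, hy, Algebra.algebraMap_eq_smul_one, fromBlocks_smul]

/-- With `R` the block matrix, `p(R)` has zero second block column and `R - 1` has zero first block
row, so `p(R) (R - 1) = 0` whatever the lower left blocks are. -/
theorem aeval_X_sub_one_mul_fromBlocks {ι κ : Type*} [Fintype ι] [DecidableEq ι] [Fintype κ]
    [DecidableEq κ] (x : Matrix κ ι ℂ) (S : Matrix κ κ ℂ) (p : ℂ[X]) (hp : aeval S p = 0) :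
    aeval (fromBlocks (1 : Matrix ι ι ℂ) 0 x S) ((X - C 1) * p) = 0 := by
  obtain ⟨y, hy⟩ := aeval_fromBlocks_lower (1 : Matrix ι ι ℂ) x S p
  rw [mul_comm, map_mul, hy, hp]
  have : aeval (fromBlocks (1 : Matrix ι ι ℂ) 0 x S) (X - C (1 : ℂ)) = fromBlocks 0 0 x (S - 1) := by
    rw [map_sub, aeval_X, aeval_C, map_one, ← fromBlocks_one, sub_eq_add_neg, fromBlocks_neg,
      fromBlocks_add]
    simp [sub_eq_add_neg]
  rw [this, fromBlocks_multiply]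
  simp

/-- Bounded matrix coefficients of the powers of a block triangular matrix satisfy, up to a
constant, every recurrence satisfied by the lower diagonal block. -/
theorem exists_const_of_bounded_matrix {ι κ : Type*} [Fintype ι] [DecidableEq ι] [Fintype κ]
    [DecidableEq κ] (x : Matrix κ ι ℂ) (S : Matrix κ κ ℂ) (u w : ι ⊕ κ → ℂ) {B : ℝ}
    (hB : ∀ n, ‖u ⬝ᵥ ((fromBlocks 1 0 x S) ^ n *ᵥ w)‖ ≤ B) (p : ℂ[X]) (hp : aeval S p = 0) :
    ∃ c : ℂ, aeval seqShift p
      ((fun n => u ⬝ᵥ ((fromBlocks 1 0 x S) ^ n *ᵥ w)) - fun _ => c) = 0 := by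
  refine exists_const_of_bounded p hB ?_
  have := aeval_seqShift_matrix (fromBlocks 1 0 x S) 1 u w ((X - C 1) * p)
  rw [aeval_X_sub_one_mul_fromBlocks x S p hp] at this
  simp only [one_mul] at this
  rw [this]
  ext n
  simp

end Recurrence

/-! ### Orthogonal projectors and orthonormal bases of their range. -/

section OrthProj

variable {ι κ : Type*} [Fintype ι] [DecidableEq ι] [Fintype κ] [DecidableEq κ]

theorem IsOrthProj.mulVec_of_mem {P : Matrix ι ι ℂ} {V : Submodule ℂ (ι → ℂ)}
    (h : IsOrthProj P V) {v : ι → ℂ} (hv : v ∈ V) : P *ᵥ v = v := by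
  rw [← h.2.2] at hv
  obtain ⟨w, rfl⟩ := hv
  rw [toLin'_apply, mulVec_mulVec, h.1]

/-- An orthogonal projector is the sum of the projectors onto an orthonormal basis of its
range. -/
theorem IsOrthProj.eq_sum_vecMulVec {P : Matrix ι ι ℂ} {V : Submodule ℂ (ι → ℂ)}
    (h : IsOrthProj P V) (b : κ → ι → ℂ)
    (hb : ∀ i j, star (b i) ⬝ᵥ b j = if i = j then 1 else 0)
    (hV : V ≤ Submodule.span ℂ (Set.range b)) (hbV : ∀ i, b i ∈ V) :
    P = ∑ i, vecMulVec (b i) (star (b i)) := by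
  set Q := ∑ i, vecMulVec (b i) (star (b i)) with hQ
  have hQb (j : κ) : Q *ᵥ b j = b j := by
    simp [hQ, sum_mulVec, vecMulVec_mulVec, hb]
  have hQspan : ∀ v ∈ Submodule.span ℂ (Set.range b), Q *ᵥ v = v := by
    intro v hv
    induction hv using Submodule.span_induction with
    | mem x hx => obtain ⟨j, rfl⟩ := hx; exact hQb j
    | zero => simp
    | add x y _ _ hx hy => rw [mulVec_add, hx, hy]
    | smul c x _ hx => rw [mulVec_smul, hx]
  -- `Q` fixes the range of `P` and `P` fixes the range of `Q`; as both are self-adjoint, taking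
  -- adjoints identifies them.
  have hQP : Q * P = P := by
    refine Matrix.ext_of_mulVec_single fun i => ?_
    rw [← mulVec_mulVec]
    refine hQspan _ (hV ?_)
    rw [← h.2.2]
    exact ⟨_, toLin'_apply _ _⟩
  have hPQ : P * Q = Q := by
    simp only [hQ, Finset.mul_sum, mul_vecMulVec, h.mulVec_of_mem (hbV _)]
  have hQH : Qᴴ = Q := by
    simp [hQ, conjTranspose_sum, conjTranspose_vecMulVec]
  calc P = (Q * P)ᴴ := by rw [hQP, h.2.1]
    _ = Q := by rw [conjTranspose_mul, h.2.1, hQH, hPQ]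

end OrthProj

/-! ### Orthonormal operator bases and the invariant vectors of one twirl. -/

section Basis

variable {n : Type*} [Fintype n]

theorem star_vecTensor_dotProduct (Z W Z' W' : Matrix n n ℂ) :
    star (vecTensor Z W) ⬝ᵥ vecTensor Z' W' = (Zᴴ * Z').trace * (Wᴴ * W').trace := by
  have h (Z Z' : Matrix n n ℂ) : (Zᴴ * Z').trace = ∑ p : n × n, star (Z p.1 p.2) * Z' p.1 p.2 := by
    rw [Fintype.sum_prod_type, Finset.sum_comm]
    simp [trace, Matrix.mul_apply]
  rw [h, h, Finset.sum_mul_sum, dotProduct, Fintype.sum_prod_type]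
  refine Finset.sum_congr rfl fun p _ => Finset.sum_congr rfl fun q _ => ?_
  simp only [vecTensor, vectorize, Pi.star_apply, star_mul']
  ring

omit [Fintype n] in
theorem vecTensor_smul_smul (c c' : ℂ) (Z W : Matrix n n ℂ) :
    vecTensor (c • Z) (c' • W) = (c * c') • vecTensor Z W := by
  ext p
  simp only [vecTensor, vectorize, Matrix.smul_apply, Pi.smul_apply, smul_eq_mul]
  ring

variable {d : ℕ}

/-- Orthonormality says `B * C = 1`. The index sets have equal cardinality, so `C * B = 1` too,
which is completeness; `1 ≤ d` keeps `d ^ 2 - 1` from truncating. -/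
theorem OpBasis.complete (X : OpBasis d) (hd : 1 ≤ d) (i j k l : Fin d) :
    ∑ μ, X.X μ i j * star (X.X μ k l) = if i = k ∧ j = l then 1 else 0 := by
  let B : Matrix (Option (Fin (d ^ 2 - 1))) (Fin d × Fin d) ℂ :=
    Matrix.of fun μ p => star (X.X μ p.1 p.2)
  let C : Matrix (Fin d × Fin d) (Option (Fin (d ^ 2 - 1))) ℂ :=
    Matrix.of fun p μ => X.X μ p.1 p.2
  have hBC : B * C = 1 := by
    ext μ ν
    rw [Matrix.one_apply, ← X.orthonormal μ ν, Matrix.mul_apply, Fintype.sum_prod_type,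
      Finset.sum_comm]
    simp [B, C, trace, Matrix.mul_apply]
  have hcard : Fintype.card (Option (Fin (d ^ 2 - 1))) = Fintype.card (Fin d × Fin d) := by
    have : 1 ≤ d ^ 2 := Nat.one_le_pow _ _ hd
    simp only [Fintype.card_option, Fintype.card_fin, Fintype.card_prod]
    rw [← pow_two]; omega
  have h := congrFun (congrFun ((mul_eq_one_comm_of_card_eq _ _ _ hcard).mp hBC) (i, j)) (k, l)
  rw [Matrix.mul_apply, Matrix.one_apply] at h
  simpa [B, C] using h

theorem OpBasis.conjTranspose_zero (X : OpBasis d) : (X.X none)ᴴ = X.X none := by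
  rw [X.zero, conjTranspose_smul, conjTranspose_one]
  simp

theorem sum_vecTensor_conjTranspose (X : OpBasis d) (hd : 1 ≤ d) :
    ∑ μ, vecTensor (X.X μ) (X.X μ)ᴴ = vectorizeTwo (flipOp (Fin d)) := by
  ext ⟨⟨i, k⟩, ⟨j, l⟩⟩
  simp only [Finset.sum_apply, vecTensor, vectorize, conjTranspose_apply, vectorizeTwo, flipOp,
    Matrix.of_apply]
  rw [X.complete hd]
  simp [eq_comm]

theorem alpha_pos (hd : 2 ≤ d) : 0 < alpha d := by
  have : (2 : ℝ) ≤ d := by exact_mod_cast hd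
  exact one_div_pos.mpr (by nlinarith)

theorem alpha_mul_card (hd : 2 ≤ d) : alpha d * ((d ^ 2 - 1 : ℕ) : ℝ) = 1 := by
  have : (2 : ℝ) ≤ d := by exact_mod_cast hd
  rw [alpha, Nat.cast_sub (Nat.one_le_pow _ _ (by omega))]
  push_cast
  exact one_div_mul_cancel (by nlinarith)

theorem ket_zero (X : OpBasis d) : ket X 0 = vecTensor (X.X none) (X.X none) := rfl

theorem ket_one (X : OpBasis d) :
    ket X 1 = ((√(alpha d) : ℝ) : ℂ) • ∑ i, vecTensor (X.X (some i)) (X.X (some i))ᴴ := rfl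

theorem trace_mul_conjTranspose_basis (X : OpBasis d) (μ ν : Option (Fin (d ^ 2 - 1))) :
    ((X.X μ)ᴴᴴ * (X.X ν)ᴴ).trace = if μ = ν then 1 else 0 := by
  rw [conjTranspose_conjTranspose, trace_mul_comm, X.orthonormal]
  simp [eq_comm]

theorem ket_orthonormal (X : OpBasis d) (hd : 2 ≤ d) (i j : Fin 2) :
    star (ket X i) ⬝ᵥ ket X j = if i = j then 1 else 0 := by
  have h0 : ket X 0 = vecTensor (X.X none) (X.X none)ᴴ := by rw [X.conjTranspose_zero]; rfl
  fin_cases i <;> fin_cases j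
  · simp [ket_zero, star_vecTensor_dotProduct, X.orthonormal]
  · simp [h0, ket_one, dotProduct_sum, star_vecTensor_dotProduct, X.orthonormal]
  · simp [h0, ket_one, sum_dotProduct, star_vecTensor_dotProduct, X.orthonormal]
  · have hs : ((√(alpha d) : ℝ) : ℂ) * ((√(alpha d) : ℝ) : ℂ) * ((d ^ 2 - 1 : ℕ) : ℂ) = 1 := by
      rw [← Complex.ofReal_mul, Real.mul_self_sqrt (alpha_pos hd).le]
      exact_mod_cast alpha_mul_card hd
    simp only [Fin.mk_one, ket_one, star_smul, star_sum, smul_dotProduct, dotProduct_smul,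
      sum_dotProduct, dotProduct_sum, star_vecTensor_dotProduct, X.orthonormal,
      trace_mul_conjTranspose_basis]
    rw [mul_right_comm, mul_assoc] at hs
    simpa using hs

/-- The vectorized identity is `d |0⟩` and, by completeness, the vectorized flip is `|0⟩ + α^{-1/2}
|1⟩`; this triangular change of basis shows that the kets span the range of the twirl. -/
theorem twirl_eq_sum_ket (X : OpBasis d) (hd : 2 ≤ d) :
    twirl (Fin d) = ∑ i, vecMulVec (ket X i) (star (ket X i)) := by
  have : Nontrivial (Fin d) := Fin.nontrivial_iff_two_le.mpr hd
  have hα := alpha_pos hd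
  have hd0 : (0 : ℝ) < d := by exact_mod_cast (by omega : 0 < d)
  have hone : vectorizeTwo (1 : Matrix (Fin d × Fin d) (Fin d × Fin d) ℂ) =
      (d : ℂ) • ket X 0 := by
    have : vectorizeTwo (1 : Matrix (Fin d × Fin d) (Fin d × Fin d) ℂ) = vecTensor 1 1 := by
      ext p
      simp [vectorizeTwo, vecTensor, vectorize, Matrix.one_apply, ← ite_and, and_comm]
    rw [ket_zero, X.zero, vecTensor_smul_smul, smul_smul, this, ← Complex.ofReal_mul,
      ← Complex.ofReal_natCast, ← Complex.ofReal_mul]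
    rw [show (d : ℝ) * (1 / √d * (1 / √d)) = 1 by
      rw [div_mul_div_comm, Real.mul_self_sqrt hd0.le]; field_simp]
    simp
  have hflip : vectorizeTwo (flipOp (Fin d)) =
      ket X 0 + ((√(alpha d))⁻¹ : ℂ) • ket X 1 := by
    have : ((√(alpha d) : ℝ) : ℂ) ≠ 0 := by exact_mod_cast (Real.sqrt_pos.mpr hα).ne'
    rw [← sum_vecTensor_conjTranspose X (by omega), Fintype.sum_option, ket_zero, ket_one,
      smul_smul, inv_mul_cancel₀ this, one_smul, X.conjTranspose_zero]
  refine (isOrthProj_twirl (n := Fin d)).eq_sum_vecMulVec (ket X) (ket_orthonormal X hd) ?_ ?_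
  · have h (i) : ket X i ∈ Submodule.span ℂ (Set.range (ket X)) :=
      Submodule.subset_span ⟨i, rfl⟩
    rw [Submodule.span_le]
    rintro _ (rfl | rfl)
    · rw [hone]; exact Submodule.smul_mem _ _ (h 0)
    · rw [hflip]; exact Submodule.add_mem _ (h 0) (Submodule.smul_mem _ _ (h 1))
  · set V := Submodule.span ℂ {vectorizeTwo (1 : Matrix (Fin d × Fin d) (Fin d × Fin d) ℂ),
      vectorizeTwo (flipOp (Fin d))} with hV
    have h₁ : (d : ℂ) • ket X 0 ∈ V := hone ▸ Submodule.subset_span (by simp)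
    have h₂ : ket X 0 + ((√(alpha d))⁻¹ : ℂ) • ket X 1 ∈ V := hflip ▸ Submodule.subset_span (by simp)
    have h0 : ket X 0 ∈ V :=
      (Submodule.smul_mem_iff _ (by exact_mod_cast hd0.ne')).mp h₁
    have h1 : ket X 1 ∈ V := (Submodule.smul_mem_iff _ (inv_ne_zero
      (by exact_mod_cast (Real.sqrt_pos.mpr hα).ne'))).mp ((Submodule.add_mem_iff_right _ h0).mp h₂)
    intro i
    fin_cases i
    exacts [h0, h1]

end Basis

/-! ### The four invariant vectors of the local twirl. -/

section Product

/-- The reordering of tensor factors that separates the two systems. -/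
def partEquiv (a b : Type*) : ((a × b) × (a × b)) × ((a × b) × (a × b)) ≃
    ((a × a) × (a × a)) × ((b × b) × (b × b)) where
  toFun p := (partA p, partB p)
  invFun q := (((q.1.1.1, q.2.1.1), (q.1.1.2, q.2.1.2)), ((q.1.2.1, q.2.2.1), (q.1.2.2, q.2.2.2)))
  left_inv _ := rfl
  right_inv _ := rfl

theorem sum_partA_mul_partB {a b : Type*} [Fintype a] [Fintype b] (f : (a × a) × (a × a) → ℂ)
    (g : (b × b) × (b × b) → ℂ) :
    ∑ p, f (partA p) * g (partB p) = (∑ p, f p) * ∑ q, g q := by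
  rw [Finset.sum_mul_sum, ← Fintype.sum_prod_type']
  exact Fintype.sum_equiv (partEquiv a b) _ _ fun _ => rfl

variable {dA dB : ℕ}

theorem ketAB_orthonormal (X : OpBasis dA) (Y : OpBasis dB) (hA : 2 ≤ dA) (hB : 2 ≤ dB)
    (i j k l : Fin 2) :
    star (ketAB X Y i j) ⬝ᵥ ketAB X Y k l = if i = k ∧ j = l then 1 else 0 := by
  have h := sum_partA_mul_partB (fun p => star (ket X i p) * ket X k p)
    (fun p => star (ket Y j p) * ket Y l p)
  have hX := ket_orthonormal X hA i k
  have hY := ket_orthonormal Y hB j l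
  simp only [dotProduct, Pi.star_apply] at hX hY ⊢
  rw [hX, hY] at h
  rw [show (if i = k ∧ j = l then (1 : ℂ) else 0) = (if i = k then 1 else 0) *
    if j = l then 1 else 0 by rw [ite_and, ite_mul, one_mul, zero_mul], ← h]
  refine Finset.sum_congr rfl fun p _ => ?_
  simp only [ketAB, star_mul']
  ring

theorem basisKet_orthonormal (X : OpBasis dA) (Y : OpBasis dB) (hA : 2 ≤ dA) (hB : 2 ≤ dB)
    (s t : Unit ⊕ Fin 3) :
    star (basisKet X Y s) ⬝ᵥ basisKet X Y t = if s = t then 1 else 0 := by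
  have h := ketAB_orthonormal X Y hA hB
  rcases s with s | s <;> rcases t with t | t
  · simp [basisKet, h]
  · fin_cases t <;> simp [basisKet, h]
  · fin_cases s <;> simp [basisKet, h]
  · fin_cases s <;> fin_cases t <;> simp [basisKet, h]

theorem localTwirl_eq_sum_basisKet (X : OpBasis dA) (Y : OpBasis dB) (hA : 2 ≤ dA)
    (hB : 2 ≤ dB) : localTwirl (Fin dA) (Fin dB) =
      ∑ s, vecMulVec (basisKet X Y s) (star (basisKet X Y s)) := by
  ext p q
  rw [localTwirl_apply, twirl_eq_sum_ket X hA, twirl_eq_sum_ket Y hB]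
  simp only [Matrix.sum_apply, vecMulVec_apply, Fintype.sum_sum_type, Fin.sum_univ_two,
    Fin.sum_univ_three, basisKet, ketAB, Pi.star_apply, Finset.univ_unique, Finset.sum_singleton,
    cons_val, star_mul']
  ring

end Product

/-! ### Consequences of positivity for channels and states. -/

section Channel

variable {n : Type*} [Fintype n] [DecidableEq n] {E : SuperOp n}

omit [DecidableEq n] in
theorem IsChannel.posSemidef (hE : IsChannel E) {Z : Matrix n n ℂ} (hZ : Z.PosSemidef) :
    (E Z).PosSemidef := by
  have h := hE.1 1 (Z.submatrix Prod.snd Prod.snd) (hZ.submatrix _)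
  exact h.submatrix fun i : n => ((0 : Fin 1), i)

/-- Two-positivity applied to `Wᴴ W` with `W = (1 Z)`, whose off-diagonal blocks are `Z` and `Zᴴ`:
the image is positive, hence Hermitian, and its off-diagonal blocks are mutually adjoint. -/
theorem IsChannel.map_conjTranspose (hE : IsChannel E) (Z : Matrix n n ℂ) : E Zᴴ = (E Z)ᴴ := by
  let W : Matrix n (Fin 2 × n) ℂ := Matrix.of fun i p => if p.1 = 0 then (1 : Matrix n n ℂ) i p.2
    else Z i p.2
  have h := (hE.1 2 _ (posSemidef_conjTranspose_mul_self W)).isHermitian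
  have e₁ : (Matrix.of fun a b => (Wᴴ * W) ((0 : Fin 2), a) ((1 : Fin 2), b)) = Z := by
    ext a b
    simp [W, Matrix.mul_apply, Matrix.one_apply, apply_ite]
  have e₂ : (Matrix.of fun a b => (Wᴴ * W) ((1 : Fin 2), a) ((0 : Fin 2), b)) = Zᴴ := by
    ext a b
    simp [W, Matrix.mul_apply, Matrix.one_apply]
  ext a b
  have := congrFun (congrFun h (1, a)) (0, b)
  simp only [amplify, conjTranspose_apply, Matrix.of_apply] at this
  simp only [← e₂]
  rw [conjTranspose_apply, ← this, e₁]

-- Writing `σ = Aᴴ A`, the squared column norms of `A` sum to 1, and the entries of `σ` are inner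
-- products of columns. This is the source of the uniform bound on the signal.
open scoped MatrixOrder in
theorem norm_apply_le_of_isState {σ : Matrix n n ℂ} (hσ : IsState σ) (i j : n) : ‖σ i j‖ ≤ 1 := by
  obtain ⟨A, rfl⟩ : ∃ A : Matrix n n ℂ, σ = Aᴴ * A := by
    obtain ⟨A, hA⟩ := CStarAlgebra.nonneg_iff_eq_star_mul_self.mp hσ.1.nonneg
    exact ⟨A, hA⟩
  have htr : ∑ j, ∑ k, ‖A k j‖ ^ 2 = 1 := by
    have h : ((∑ j, ∑ k, ‖A k j‖ ^ 2 : ℝ) : ℂ) = (Aᴴ * A).trace := by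
      simp [trace, Matrix.mul_apply, Complex.conj_mul']
    exact_mod_cast h.trans hσ.2
  have hcol (j : n) : ∑ k, ‖A k j‖ ^ 2 ≤ 1 := htr ▸ Finset.single_le_sum
    (f := fun j => ∑ k, ‖A k j‖ ^ 2) (fun j _ => by positivity) (Finset.mem_univ j)
  calc ‖(Aᴴ * A) i j‖ ≤ ∑ k, ‖A k i‖ * ‖A k j‖ := by
        rw [Matrix.mul_apply]
        refine (norm_sum_le _ _).trans_eq ?_
        simp
    _ ≤ ∑ k, (‖A k i‖ ^ 2 + ‖A k j‖ ^ 2) / 2 :=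
        Finset.sum_le_sum fun k _ => by nlinarith [sq_nonneg (‖A k i‖ - ‖A k j‖)]
    _ ≤ 1 := by
        rw [← Finset.sum_div, Finset.sum_add_distrib]
        linarith [hcol i, hcol j]

end Channel

/-! ### The matrix of the twirled channel in the four invariant vectors. -/

section MatrixEntries

variable {dA dB : ℕ} (X : OpBasis dA) (Y : OpBasis dB)

/-- The elements `X_μ ⊗ Y_ν` of the product basis. -/
def pairBasis (p : PairIx dA dB) : Matrix (Fin dA × Fin dB) (Fin dA × Fin dB) ℂ :=
  X.X p.1 ⊗ₖ Y.X p.2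

/-- The non-trivial sectors in the order `A, AB, B`. -/
def sectorOf : Fin 3 → Sector := ![.A, .AB, .B]

/-- The indices of the product basis in a sector. -/
def sectorSet (s : Sector) : Finset (PairIx dA dB) := Finset.univ.filter (InSector s)

/-- The indices of the product basis that enter a vector of `basisKet`. -/
def classOf : Unit ⊕ Fin 3 → Finset (PairIx dA dB)
  | .inl _ => {(none, none)}
  | .inr i => sectorSet (sectorOf i)

/-- The normalization of a vector of `basisKet`. -/
noncomputable def classWeight (dA dB : ℕ) : Unit ⊕ Fin 3 → ℝ
  | .inl _ => 1
  | .inr i => √(sectorAlpha dA dB (sectorOf i))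

theorem vecTensor_kronecker {a b : Type*} (A A' : Matrix a a ℂ) (B B' : Matrix b b ℂ)
    (p : ((a × b) × (a × b)) × ((a × b) × (a × b))) :
    vecTensor (A ⊗ₖ B) (A' ⊗ₖ B') p =
      vecTensor A A' (partA p) * vecTensor B B' (partB p) := by
  simp only [vecTensor, vectorize, kroneckerMap_apply, partA, partB]
  ring

theorem sum_sectorSet_A {M : Type*} [AddCommMonoid M] (f : PairIx dA dB → M) :
    ∑ p ∈ sectorSet .A, f p = ∑ i, f (some i, none) := by
  rw [sectorSet, Finset.sum_filter, Fintype.sum_prod_type]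
  simp [Fintype.sum_option, InSector]

theorem sum_sectorSet_AB {M : Type*} [AddCommMonoid M] (f : PairIx dA dB → M) :
    ∑ p ∈ sectorSet .AB, f p = ∑ i, ∑ j, f (some i, some j) := by
  rw [sectorSet, Finset.sum_filter, Fintype.sum_prod_type]
  simp [Fintype.sum_option, InSector]

theorem sum_sectorSet_B {M : Type*} [AddCommMonoid M] (f : PairIx dA dB → M) :
    ∑ p ∈ sectorSet .B, f p = ∑ j, f (none, some j) := by
  rw [sectorSet, Finset.sum_filter, Fintype.sum_prod_type]
  simp [Fintype.sum_option, InSector]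

/-- A uniform formula for the four vectors, so that all sixteen matrix entries come from one
computation. Hermiticity of `X_0` and `Y_0` lets them fit the pattern `Z ⊗ Z†`. -/
theorem basisKet_eq_sum (hA : 2 ≤ dA) (s : Unit ⊕ Fin 3) :
    basisKet X Y s = (classWeight dA dB s : ℂ) •
      ∑ p ∈ classOf s, vecTensor (pairBasis X Y p) (pairBasis X Y p)ᴴ := by
  ext p
  rcases s with s | s
  · simp [basisKet, ketAB, classOf, classWeight, pairBasis, conjTranspose_kronecker,
      vecTensor_kronecker, ket_zero, X.conjTranspose_zero, Y.conjTranspose_zero]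
  · have hα := alpha_pos hA
    fin_cases s
    · simp [basisKet, ketAB, classOf, classWeight, pairBasis, conjTranspose_kronecker, sectorOf,
        vecTensor_kronecker, ket_zero, ket_one, Y.conjTranspose_zero, sum_sectorSet_A,
        sectorAlpha, Finset.sum_mul, mul_assoc]
    · simp [basisKet, ketAB, classOf, classWeight, pairBasis, conjTranspose_kronecker, sectorOf,
        vecTensor_kronecker, ket_one, sum_sectorSet_AB, sectorAlpha, Real.sqrt_mul hα.le,
        ← Finset.sum_mul_sum]
      ring
    · simp [basisKet, ketAB, classOf, classWeight, pairBasis, conjTranspose_kronecker, sectorOf,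
        vecTensor_kronecker, ket_zero, ket_one, X.conjTranspose_zero, sum_sectorSet_B,
        sectorAlpha, mul_left_comm, ← Finset.mul_sum]

theorem localTwirl_isHermitian :
    (localTwirl (Fin dA) (Fin dB))ᴴ = localTwirl (Fin dA) (Fin dB) := by
  ext p q
  have h₁ := congrFun (congrFun (twirl_isHermitian (n := Fin dA)) (partA p)) (partA q)
  have h₂ := congrFun (congrFun (twirl_isHermitian (n := Fin dB)) (partB p)) (partB q)
  rw [conjTranspose_apply] at h₁ h₂ ⊢
  rw [localTwirl_apply, localTwirl_apply, star_mul', h₁, h₂]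

theorem localTwirl_mulVec_basisKet (hA : 2 ≤ dA) (hB : 2 ≤ dB) (s : Unit ⊕ Fin 3) :
    localTwirl (Fin dA) (Fin dB) *ᵥ basisKet X Y s = basisKet X Y s := by
  simp only [localTwirl_eq_sum_basisKet X Y hA hB, sum_mulVec, vecMulVec_mulVec,
    basisKet_orthonormal X Y hA hB]
  simp [-Fintype.sum_sum_type]

variable {E : SuperOp (Fin dA × Fin dB)}

/-- Both outer twirls are absorbed by the kets. Because `E` commutes with adjoints, the second copy
contributes the complex conjugate of the first. -/
theorem twirled_entry (hE : IsChannel E) (hA : 2 ≤ dA) (hB : 2 ≤ dB) (s t : Unit ⊕ Fin 3) :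
    star (basisKet X Y s) ⬝ᵥ (twirled E *ᵥ basisKet X Y t) =
      ((classWeight dA dB s * classWeight dA dB t *
        ∑ p ∈ classOf s, ∑ q ∈ classOf t, ‖liouvilleIn X Y E p q‖ ^ 2 : ℝ) : ℂ) := by
  have h : star (basisKet X Y s) ᵥ* localTwirl (Fin dA) (Fin dB) = star (basisKet X Y s) := by
    have := congrArg star (localTwirl_mulVec_basisKet X Y hA hB s)
    rwa [star_mulVec, localTwirl_isHermitian] at this
  rw [twirled, ← mulVec_mulVec, ← mulVec_mulVec, localTwirl_mulVec_basisKet X Y hA hB,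
    dotProduct_mulVec, h, basisKet_eq_sum X Y hA s, basisKet_eq_sum X Y hA t, mulVec_smul,
    mulVec_sum]
  simp only [liouvilleTwo_mulVec_vecTensor, hE.map_conjTranspose, star_smul, star_sum,
    smul_dotProduct, dotProduct_smul, sum_dotProduct, dotProduct_sum, star_vecTensor_dotProduct]
  have hL (p q : PairIx dA dB) : ((pairBasis X Y p)ᴴ * E (pairBasis X Y q)).trace *
      ((pairBasis X Y p)ᴴᴴ * (E (pairBasis X Y q))ᴴ).trace =
      ((‖liouvilleIn X Y E p q‖ ^ 2 : ℝ) : ℂ) := by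
    have h₁ : ((pairBasis X Y p)ᴴ * E (pairBasis X Y q)).trace = liouvilleIn X Y E p q := rfl
    have h₂ : ((pairBasis X Y p)ᴴᴴ * (E (pairBasis X Y q))ᴴ).trace =
        star (liouvilleIn X Y E p q) := by
      rw [← h₁, ← trace_conjTranspose, conjTranspose_mul, trace_mul_comm]
    rw [h₁, h₂, Complex.star_def, Complex.mul_conj, Complex.normSq_eq_norm_sq]
  simp only [hL]
  rw [Finset.sum_comm]
  push_cast
  simp only [smul_eq_mul, ← Finset.mul_sum, Complex.star_def, Complex.conj_ofReal]
  ring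

/-- `X_0 ⊗ Y_0` is a multiple of the identity, so pairing with it is a trace, and `E` can be dropped
by trace preservation. -/
theorem liouvilleIn_zero (hE : IsChannel E) (q : PairIx dA dB) :
    liouvilleIn X Y E (none, none) q = if (none, none) = q then 1 else 0 := by
  have h : (X.X none ⊗ₖ Y.X none)ᴴ =
      (((1 / √dA : ℝ) : ℂ) * ((1 / √dB : ℝ) : ℂ)) • (1 : Matrix (Fin dA × Fin dB) (Fin dA × Fin dB) ℂ) := by
    rw [conjTranspose_kronecker, X.conjTranspose_zero, Y.conjTranspose_zero, X.zero, Y.zero,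
      smul_kronecker, kronecker_smul, one_kronecker_one, smul_smul]
  have h₁ : ((X.X none ⊗ₖ Y.X none)ᴴ * (X.X q.1 ⊗ₖ Y.X q.2)).trace =
      if (none, none) = q then 1 else 0 := by
    rw [conjTranspose_kronecker, ← mul_kronecker_mul, trace_kronecker, X.orthonormal,
      Y.orthonormal]
    simp only [Prod.ext_iff, ite_and, ite_mul, one_mul, zero_mul]
  rw [← h₁, liouvilleIn, Matrix.of_apply, h, smul_mul, smul_mul, Matrix.one_mul, Matrix.one_mul,
    trace_smul, trace_smul, hE.2]

theorem mem_sectorSet {s : Sector} {p : PairIx dA dB} : p ∈ sectorSet s ↔ InSector s p := by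
  simp [sectorSet]

theorem sum_sectorSet {M : Type*} [AddCommMonoid M] (s : Sector) (f : PairIx dA dB → M) :
    ∑ p ∈ sectorSet s, f p = ∑ p : {p : PairIx dA dB // InSector s p}, f p :=
  Finset.sum_subtype _ (fun _ => mem_sectorSet) f

theorem subU_eq_sum (s t : Sector) : subU X Y E s t = sectorAlpha dA dB s *
    ∑ p ∈ sectorSet t, ∑ q ∈ sectorSet s, ‖liouvilleIn X Y E p q‖ ^ 2 := by
  have h : ((block X Y E s t)ᴴ * block X Y E s t).trace =
      ((∑ q : {q : PairIx dA dB // InSector s q}, ∑ p : {p : PairIx dA dB // InSector t p},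
        ‖liouvilleIn X Y E p q‖ ^ 2 : ℝ) : ℂ) := by
    simp [trace, Matrix.mul_apply, block, Complex.conj_mul']
  rw [subU, h, Complex.ofReal_re, Finset.sum_comm]
  simp only [sum_sectorSet]

theorem bloch_eq_sum (t : Sector) : bloch X Y E t =
    ∑ p ∈ sectorSet t, ‖liouvilleIn X Y E p (none, none)‖ ^ 2 := by
  rw [sum_sectorSet, bloch]

theorem twirled_matrix (hE : IsChannel E) (hA : 2 ≤ dA) (hB : 2 ≤ dB) :
    (Matrix.of fun i j => star (basisKet X Y i) ⬝ᵥ (twirled E *ᵥ basisKet X Y j)) =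
      Matrix.fromBlocks 1 0 (Matrix.of fun i _ => (blochColumn X Y E i : ℂ))
        (subUMatrixC X Y E) := by
  have hα := alpha_pos hA
  have hβ := alpha_pos hB
  ext s t
  rw [Matrix.of_apply, twirled_entry X Y hE hA hB]
  rcases s with s | s
  · have h0 : ∀ t, ∑ p ∈ classOf (dA := dA) (dB := dB) (.inl s), ∑ q ∈ classOf t, ‖liouvilleIn X Y E p q‖ ^ 2 =
        if (none, none) ∈ classOf (dA := dA) (dB := dB) t then 1 else 0 := by
      intro t
      rw [classOf, Finset.sum_singleton]
      simp only [liouvilleIn_zero X Y hE]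
      rw [← Finset.sum_ite_eq (classOf t) (none, none) fun _ => (1 : ℝ)]
      refine Finset.sum_congr rfl fun q _ => ?_
      split_ifs <;> simp
    rw [h0]
    rcases t with t | t
    · simp [classOf, classWeight]
    · fin_cases t <;> simp [classOf, classWeight, sectorOf, mem_sectorSet, InSector]
  · rcases t with t | t
    · simp only [fromBlocks_apply₂₁, Matrix.of_apply]
      congr 1
      fin_cases s <;> simp [classOf, classWeight, blochColumn, sectorOf, bloch_eq_sum, sectorAlpha]
    · simp only [fromBlocks_apply₂₂, subUMatrixC, map_apply]
      congr 1
      have ha := Real.sqrt_pos.mpr hα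
      have hb := Real.sqrt_pos.mpr hβ
      have ha' := Real.mul_self_sqrt hα.le
      have hb' := Real.mul_self_sqrt hβ.le
      fin_cases s <;> fin_cases t <;>
        simp only [classOf, classWeight, sectorOf, subUMatrix, subU_eq_sum, sectorAlpha,
          Real.sqrt_mul hα.le, Real.sqrt_div hα.le, Real.sqrt_div hβ.le, Fin.mk_one, Fin.zero_eta,
          Fin.reduceFinMk, Matrix.of_apply, cons_val]
      -- With `a`, `b` for the square roots of the two `alpha`, each of the nine entries becomes an
      -- identity of rational functions in `a` and `b`.
      all_goals
        generalize √(alpha dA) = a at *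
        generalize √(alpha dB) = b at *
        simp only [← ha', ← hb']
        try field_simp

end MatrixEntries

/-! ### The averaged signal and its decay law. -/

section Signal

variable {dA dB NA NB : ℕ} {E : SuperOp (Fin dA × Fin dB)}
  {ΓA : Fin NA → Matrix.unitaryGroup (Fin dA) ℂ} {ΓB : Fin NB → Matrix.unitaryGroup (Fin dB) ℂ}
  {M ρ : Matrix (Fin dA × Fin dB) (Fin dA × Fin dB) ℂ}

theorem sum_liouvilleTwo_eq_localTwirl (hΓA : IsTwoDesign ΓA) (hΓB : IsTwoDesign ΓB) :
    (1 / ((NA : ℂ) * NB)) • ∑ i, ∑ j, liouvilleTwo (conjMap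
      ((ΓA i : Matrix (Fin dA) (Fin dA) ℂ) ⊗ₖ (ΓB j : Matrix (Fin dB) (Fin dB) ℂ))) =
      localTwirl (Fin dA) (Fin dB) := by
  ext p q
  rw [localTwirl_apply, ← hΓA, ← hΓB]
  simp only [Matrix.smul_apply, Matrix.sum_apply, liouvilleTwo_conjMap_kronecker, smul_eq_mul,
    ← Finset.sum_mul_sum]
  rw [one_div, mul_inv]
  ring

theorem sum_fin_succ_fun {k N : ℕ} {V : Type*} [AddCommMonoid V]
    (f : (Fin (k + 1) → Fin N) → V) :
    ∑ s, f s = ∑ i : Fin N, ∑ s : Fin k → Fin N, f (Fin.snoc (α := fun _ => Fin N) s i) := by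
  rw [← Fintype.sum_prod_type']
  exact (Fintype.sum_equiv (Fin.snocEquiv fun _ => Fin N) _ _ fun _ => rfl).symm

/-- The last gate is independent of the earlier ones and enters linearly on two copies, so averaging
over it alone yields one factor of the local twirl. -/
theorem sum_vecTensor_noisyCircuit (hΓA : IsTwoDesign ΓA) (hΓB : IsTwoDesign ΓB) (k : ℕ) :
    (1 / ((NA : ℂ) * NB) ^ k) • ∑ sA : Fin k → Fin NA, ∑ sB : Fin k → Fin NB,
      vecTensor (noisyCircuit E ΓA ΓB k sA sB ρ) (noisyCircuit E ΓA ΓB k sA sB ρ) =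
    (localTwirl (Fin dA) (Fin dB) * liouvilleTwo E) ^ k *ᵥ vecTensor ρ ρ := by
  induction k with
  | zero => simp [noisyCircuit]
  | succ k ih =>
    rw [pow_succ' (localTwirl (Fin dA) (Fin dB) * liouvilleTwo E), ← mulVec_mulVec, ← ih,
      ← mulVec_mulVec, ← sum_liouvilleTwo_eq_localTwirl hΓA hΓB]
    simp only [sum_fin_succ_fun (N := NA), sum_fin_succ_fun (N := NB), noisyCircuit,
      Fin.snoc_last, Fin.snoc_castSucc, LinearMap.comp_apply, ← liouvilleTwo_mulVec_vecTensor]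
    simp only [mulVec_smul, smul_mulVec, mulVec_sum, sum_mulVec, ← Finset.smul_sum, smul_smul]
    congr 1
    · rw [pow_succ, one_div_mul_one_div]
    · rw [Finset.sum_comm]
      refine Finset.sum_congr rfl fun sA _ => ?_
      conv_rhs => rw [Finset.sum_comm]
      exact Finset.sum_congr rfl fun a _ => Finset.sum_comm

theorem signal_eq_dotProduct (hM : M.IsHermitian) (hΓA : IsTwoDesign ΓA) (hΓB : IsTwoDesign ΓB)
    (k : ℕ) : signal E ΓA ΓB M ρ k = star (vecTensor M M) ⬝ᵥ
      ((localTwirl (Fin dA) (Fin dB) * liouvilleTwo E) ^ k *ᵥ vecTensor ρ ρ) := by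
  rw [← sum_vecTensor_noisyCircuit hΓA hΓB, signal]
  simp only [dotProduct_smul, dotProduct_sum, star_vecTensor_dotProduct, hM.eq, smul_eq_mul,
    pow_two]

theorem localTwirl_mul_self :
    localTwirl (Fin dA) (Fin dB) * localTwirl (Fin dA) (Fin dB) =
      localTwirl (Fin dA) (Fin dB) := by
  ext p q
  rw [Matrix.mul_apply]
  simp only [localTwirl_apply]
  have h := sum_partA_mul_partB
    (fun r => twirl (Fin dA) (partA p) r * twirl (Fin dA) r (partA q))
    (fun r => twirl (Fin dB) (partB p) r * twirl (Fin dB) r (partB q))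
  rw [← Matrix.mul_apply, ← Matrix.mul_apply, twirl_mul_self, twirl_mul_self] at h
  rw [← h]
  exact Finset.sum_congr rfl fun r _ => by ring

theorem twirled_mul_localTwirl : twirled E * localTwirl (Fin dA) (Fin dB) = twirled E := by
  rw [twirled, Matrix.mul_assoc, localTwirl_mul_self]

theorem localTwirl_mul_twirled : localTwirl (Fin dA) (Fin dB) * twirled E = twirled E := by
  rw [twirled, ← Matrix.mul_assoc, ← Matrix.mul_assoc, localTwirl_mul_self]

theorem twirled_pow_mul_localTwirl (n : ℕ) :
    twirled E ^ n * localTwirl (Fin dA) (Fin dB) =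
      (localTwirl (Fin dA) (Fin dB) * liouvilleTwo E) ^ n * localTwirl (Fin dA) (Fin dB) := by
  induction n with
  | zero => simp
  | succ n ih =>
    have h : twirled E ^ n * twirled E = twirled E ^ n * localTwirl (Fin dA) (Fin dB) *
        (liouvilleTwo E * localTwirl (Fin dA) (Fin dB)) := by
      rw [Matrix.mul_assoc, ← Matrix.mul_assoc (localTwirl _ _)]
      rfl
    rw [pow_succ, Matrix.mul_assoc, twirled_mul_localTwirl, h, ih, pow_succ]
    simp only [Matrix.mul_assoc]

theorem signal_succ (hM : M.IsHermitian) (hΓA : IsTwoDesign ΓA) (hΓB : IsTwoDesign ΓB)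
    (n : ℕ) : signal E ΓA ΓB M ρ (n + 1) = star (vecTensor M M) ⬝ᵥ
      ((twirled E ^ n * localTwirl (Fin dA) (Fin dB)) *ᵥ vecTensor (E ρ) (E ρ)) := by
  rw [signal_eq_dotProduct hM hΓA hΓB, twirled_pow_mul_localTwirl, pow_succ,
    ← liouvilleTwo_mulVec_vecTensor, mulVec_mulVec]
  simp only [Matrix.mul_assoc]

/-- `T` maps into the range of `P`, so `T B = B R`, and powers of `T` are governed by the small
matrix `R`. -/
theorem pow_mul_eq_of_compression {ι κ : Type*} [Fintype ι] [DecidableEq ι] [Fintype κ]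
    [DecidableEq κ] {P T : Matrix ι ι ℂ} {B : Matrix ι κ ℂ} {R : Matrix κ κ ℂ}
    (hBB : B * Bᴴ = P) (hPT : P * T = T) (hR : Bᴴ * (T * B) = R) (n : ℕ) :
    T ^ n * P = B * R ^ n * Bᴴ := by
  have hTB : T * B = B * R := by
    rw [← hR, ← Matrix.mul_assoc, hBB, ← Matrix.mul_assoc, hPT]
  have hpow (n : ℕ) : T ^ n * B = B * R ^ n := by
    induction n with
    | zero => simp
    | succ n ih => rw [pow_succ, Matrix.mul_assoc, hTB, ← Matrix.mul_assoc, ih, Matrix.mul_assoc,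
        ← pow_succ]
  rw [← hBB, ← Matrix.mul_assoc, hpow]

/-- The signal is a matrix coefficient of the powers of the matrix of `P_AB E^{⊗2} P_AB`. -/
theorem exists_signal_eq_block (hE : IsChannel E) (hM : M.IsHermitian) (hA : 2 ≤ dA)
    (hB : 2 ≤ dB) (X : OpBasis dA) (Y : OpBasis dB) :
    ∃ u w : Unit ⊕ Fin 3 → ℂ, ∀ (NA NB : ℕ) (ΓA : Fin NA → Matrix.unitaryGroup (Fin dA) ℂ)
      (ΓB : Fin NB → Matrix.unitaryGroup (Fin dB) ℂ), IsTwoDesign ΓA → IsTwoDesign ΓB →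
      ∀ n, signal E ΓA ΓB M ρ (n + 1) = u ⬝ᵥ
        (Matrix.fromBlocks 1 0 (Matrix.of fun i _ => (blochColumn X Y E i : ℂ))
          (subUMatrixC X Y E) ^ n *ᵥ w) := by
  let B := (Matrix.of (basisKet X Y))ᵀ
  have hBB : B * Bᴴ = localTwirl (Fin dA) (Fin dB) := by
    rw [localTwirl_eq_sum_basisKet X Y hA hB]
    ext p q
    simp only [Matrix.mul_apply, Matrix.sum_apply, vecMulVec_apply]
    rfl
  have hR : Bᴴ * (twirled E * B) =
      Matrix.fromBlocks 1 0 (Matrix.of fun i _ => (blochColumn X Y E i : ℂ))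
        (subUMatrixC X Y E) := by
    rw [← twirled_matrix X Y hE hA hB]
    ext s t
    rw [Matrix.mul_apply]
    rfl
  refine ⟨star (vecTensor M M) ᵥ* B, Bᴴ *ᵥ vecTensor (E ρ) (E ρ), ?_⟩
  intro NA NB ΓA ΓB hΓA hΓB n
  rw [signal_succ hM hΓA hΓB, pow_mul_eq_of_compression hBB localTwirl_mul_twirled hR,
    ← mulVec_mulVec, ← mulVec_mulVec, dotProduct_mulVec]

theorem IsState.noisyCircuit (hρ : IsState ρ) (hE : IsChannel E) (k : ℕ) (sA : Fin k → Fin NA)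
    (sB : Fin k → Fin NB) : IsState (noisyCircuit E ΓA ΓB k sA sB ρ) := by
  induction k with
  | zero => exact hρ
  | succ k ih =>
    obtain ⟨h₁, h₂⟩ := ih (fun i => sA i.castSucc) (fun i => sB i.castSucc)
    refine ⟨(hE.posSemidef h₁).mul_mul_conjTranspose_same _, ?_⟩
    set U := (ΓA (sA (Fin.last k)) : Matrix (Fin dA) (Fin dA) ℂ) ⊗ₖ
      (ΓB (sB (Fin.last k)) : Matrix (Fin dB) (Fin dB) ℂ) with hU
    have hUU : Uᴴ * U = 1 := by
      rw [hU, conjTranspose_kronecker, ← mul_kronecker_mul, ← star_eq_conjTranspose,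
        ← star_eq_conjTranspose, mem_unitaryGroup_iff'.mp (ΓA _).2,
        mem_unitaryGroup_iff'.mp (ΓB _).2, one_kronecker_one]
    change (U * E _ * Uᴴ).trace = 1
    rw [trace_mul_comm, ← Matrix.mul_assoc, hUU, Matrix.one_mul, hE.2, h₂]

theorem norm_trace_mul_le {n : Type*} [Fintype n] [DecidableEq n] (M : Matrix n n ℂ)
    {σ : Matrix n n ℂ} (hσ : IsState σ) : ‖(M * σ).trace‖ ≤ ∑ i, ∑ j, ‖M i j‖ := by
  simp only [trace, diag_apply, Matrix.mul_apply]
  refine (norm_sum_le _ _).trans (Finset.sum_le_sum fun i _ => (norm_sum_le _ _).trans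
    (Finset.sum_le_sum fun j _ => ?_))
  rw [norm_mul]
  exact mul_le_of_le_one_right (norm_nonneg _) (norm_apply_le_of_isState hσ _ _)

theorem norm_signal_le (hρ : IsState ρ) (hE : IsChannel E) (k : ℕ) :
    ‖signal E ΓA ΓB M ρ k‖ ≤ (∑ i, ∑ j, ‖M i j‖) ^ 2 := by
  set B := (∑ i, ∑ j, ‖M i j‖) ^ 2 with hB
  have hB0 : 0 ≤ B := sq_nonneg _
  have hsum : ‖∑ sA : Fin k → Fin NA, ∑ sB : Fin k → Fin NB,
      (M * noisyCircuit E ΓA ΓB k sA sB ρ).trace ^ 2‖ ≤ ((NA : ℝ) * NB) ^ k * B := by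
    calc _ ≤ ∑ _sA : Fin k → Fin NA, ∑ _sB : Fin k → Fin NB, B := by
          refine norm_sum_le_of_le _ fun sA _ => norm_sum_le_of_le _ fun sB _ => ?_
          rw [norm_pow]
          exact pow_le_pow_left₀ (norm_nonneg _)
            (norm_trace_mul_le M (hρ.noisyCircuit hE k sA sB)) 2
      _ = _ := by simp [mul_pow, mul_assoc]
  rw [signal, norm_mul]
  have hn : ‖1 / ((NA : ℂ) * NB) ^ k‖ = (((NA : ℝ) * NB) ^ k)⁻¹ := by simp
  rw [hn]
  calc _ ≤ (((NA : ℝ) * NB) ^ k)⁻¹ * (((NA : ℝ) * NB) ^ k * B) := by gcongr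
    _ = ((((NA : ℝ) * NB) ^ k)⁻¹ * ((NA : ℝ) * NB) ^ k) * B := by ring
    -- Only an inequality: for an empty gate set and `k ≥ 1` the normalization is `0⁻¹ = 0`.
    _ ≤ 1 * B := by gcongr; exact inv_mul_le_one
    _ = B := one_mul B

theorem signal_eq_ofReal_re (hρ : IsState ρ) (hE : IsChannel E) (hM : M.IsHermitian) (k : ℕ) :
    signal E ΓA ΓB M ρ k = ((signal E ΓA ΓB M ρ k).re : ℂ) := by
  refine (Complex.conj_eq_iff_re.mp ?_).symm
  have h (sA : Fin k → Fin NA) (sB : Fin k → Fin NB) :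
      (starRingEnd ℂ) (M * noisyCircuit E ΓA ΓB k sA sB ρ).trace =
        (M * noisyCircuit E ΓA ΓB k sA sB ρ).trace := by
    have hσ := (hρ.noisyCircuit (ΓA := ΓA) (ΓB := ΓB) hE k sA sB).1.isHermitian
    rw [← Complex.star_def, ← trace_conjTranspose, conjTranspose_mul, hM.eq, hσ.eq,
      trace_mul_comm]
  simp only [signal, map_mul, map_sum, map_pow, h, map_div₀, map_one, Complex.conj_natCast]

open Polynomial in
/-- Up to a constant, the signal satisfies every recurrence satisfied by the matrix of
sub-unitarities. -/
theorem exists_signal_eq_const_add (hρ : IsState ρ) (hE : IsChannel E) (hM : M.IsHermitian)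
    (hA : 2 ≤ dA) (hB : 2 ≤ dB) (X : OpBasis dA) (Y : OpBasis dB) (p : ℂ[X])
    (hp : aeval (subUMatrixC X Y E) p = 0) :
    ∃ (c₀ : ℂ) (g : ℕ → ℂ), aeval seqShift p g = 0 ∧
      ∀ (NA NB : ℕ) (ΓA : Fin NA → Matrix.unitaryGroup (Fin dA) ℂ)
        (ΓB : Fin NB → Matrix.unitaryGroup (Fin dB) ℂ), IsTwoDesign ΓA → IsTwoDesign ΓB →
      ∀ k : ℕ, 1 ≤ k → signal E ΓA ΓB M ρ k = c₀ + g (k - 1) := by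
  obtain ⟨u, w, h⟩ := exists_signal_eq_block (ρ := ρ) hE hM hA hB X Y
  -- The constants must precede the choice of designs, while boundedness of the coefficient sequence
  -- is read off from the signal of one pair of designs. If there is no such pair, the claim is
  -- vacuous.
  by_cases hex : ∃ (NA NB : ℕ) (ΓA : Fin NA → Matrix.unitaryGroup (Fin dA) ℂ)
      (ΓB : Fin NB → Matrix.unitaryGroup (Fin dB) ℂ), IsTwoDesign ΓA ∧ IsTwoDesign ΓB
  · obtain ⟨NA, NB, ΓA, ΓB, hΓA, hΓB⟩ := hex
    obtain ⟨c, hc⟩ := exists_const_of_bounded_matrix _ (subUMatrixC X Y E) u w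
      (fun n => by rw [← h NA NB ΓA ΓB hΓA hΓB n]; exact norm_signal_le hρ hE _) p hp
    refine ⟨c, _, hc, fun NA NB ΓA ΓB hΓA hΓB k hk => ?_⟩
    obtain ⟨n, rfl⟩ := Nat.exists_eq_add_of_le' hk
    simp [h NA NB ΓA ΓB hΓA hΓB n]
  · exact ⟨0, 0, map_zero _, fun NA NB ΓA ΓB hΓA hΓB => (hex ⟨NA, NB, ΓA, ΓB, hΓA, hΓB⟩).elim⟩

-- Conjugation by `Q` turns `p(S)` into the diagonal matrix of the values `p(lam i)`. Products over
-- distinct eigenvalues therefore annihilate `S`.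
open Polynomial in
theorem IsDiagonalizedBy.aeval_eq_zero_iff {m : ℕ} {S : Matrix (Fin m) (Fin m) ℂ}
    {lam : Fin m → ℂ} (h : IsDiagonalizedBy S lam) (p : ℂ[X]) :
    aeval S p = 0 ↔ ∀ i, p.eval (lam i) = 0 := by
  obtain ⟨Q, hQ, hS⟩ := h
  have hSQ : S * Q = Q * diagonal lam := by
    rw [hS, Matrix.mul_assoc, nonsing_inv_mul _ hQ, Matrix.mul_one]
  have hp : aeval S p * Q = Q * diagonal fun i => p.eval (lam i) := by
    induction p using Polynomial.induction_on' with
    | add p q hp hq =>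
      rw [map_add, Matrix.add_mul, hp, hq, ← Matrix.mul_add, diagonal_add]
      simp
    | monomial n a =>
      have : S ^ n * Q = Q * diagonal lam ^ n :=
        ((show SemiconjBy Q (diagonal lam) S from hSQ.symm).pow_right n).eq.symm
      rw [aeval_monomial, Algebra.algebraMap_eq_smul_one, smul_mul_assoc, one_mul,
        Matrix.smul_mul, this, diagonal_pow, ← Matrix.mul_smul, ← diagonal_smul]
      congr 2
      ext i
      simp
  have hQu : IsUnit Q := (isUnit_iff_isUnit_det Q).mpr hQ
  rw [← hQu.mul_left_eq_zero, hp, hQu.mul_right_eq_zero, ← diagonal_zero, diagonal_eq_diagonal_iff]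

open Polynomial in
/-- The decay law for a diagonalizable matrix of sub-unitarities with eigenvalues among the
`u i`. -/
theorem exists_signal_eq_sum_pow (hρ : IsState ρ) (hE : IsChannel E) (hM : M.IsHermitian)
    (hA : 2 ≤ dA) (hB : 2 ≤ dB) (X : OpBasis dA) (Y : OpBasis dB) {lam u : Fin 3 → ℂ}
    (hlam : IsDiagonalizedBy (subUMatrixC X Y E) lam) (hu : ∀ i, ∃ j, u j = lam i) :
    ∃ (c₀ : ℂ) (c : Fin 3 → ℂ),
      ∀ (NA NB : ℕ) (ΓA : Fin NA → Matrix.unitaryGroup (Fin dA) ℂ)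
        (ΓB : Fin NB → Matrix.unitaryGroup (Fin dB) ℂ), IsTwoDesign ΓA → IsTwoDesign ΓB →
      ∀ k : ℕ, 1 ≤ k → signal E ΓA ΓB M ρ k = c₀ + ∑ i, c i * u i ^ (k - 1) := by
  obtain ⟨c₀, g, hg, h⟩ := exists_signal_eq_const_add (ρ := ρ) hρ hE hM hA hB X Y
    -- Taking the image makes the roots simple, so no binomial terms arise. Only the inclusion of
    -- the eigenvalues among the `u i` matters, not their order or multiplicity.
    (∏ z ∈ Finset.univ.image u, (Polynomial.X - C z)) (by
      rw [hlam.aeval_eq_zero_iff]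
      intro i
      rw [eval_prod]
      obtain ⟨j, hj⟩ := hu i
      exact Finset.prod_eq_zero (Finset.mem_image_of_mem u (Finset.mem_univ j)) (by simp [hj]))
  obtain ⟨c, hc⟩ := eq_sum_of_aeval_squarefree u g hg
  exact ⟨c₀, c, fun NA NB ΓA ΓB hΓA hΓB k hk => by rw [h NA NB ΓA ΓB hΓA hΓB k hk, hc]⟩

end Signal

/-! ### Separable channels. -/

section Separable

variable {dA dB : ℕ} {X : OpBasis dA} {Y : OpBasis dB} {E : SuperOp (Fin dA × Fin dB)}

theorem IsSeparableChannel.exists_liouvilleIn_eq_sum (hE : IsSeparableChannel E) :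
    ∃ (r : ℕ) (p : Fin r → ℝ) (F : Fin r → SuperOp (Fin dA)) (G : Fin r → SuperOp (Fin dB)),
      (∀ k, IsChannel (F k)) ∧ (∀ k, IsChannel (G k)) ∧ ∀ s t, liouvilleIn X Y E s t =
        ∑ k, (p k : ℂ) * (((X.X s.1)ᴴ * F k (X.X t.1)).trace *
          ((Y.X s.2)ᴴ * G k (Y.X t.2)).trace) := by
  obtain ⟨r, p, F, G, -, -, hF, hG, rfl⟩ := hE
  refine ⟨r, p, F, G, hF, hG, fun s t => ?_⟩
  simp only [liouvilleIn, Matrix.of_apply, LinearMap.sum_apply, LinearMap.smul_apply,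
    tensorMap_kronecker, conjTranspose_kronecker, Finset.mul_sum, trace_sum, Matrix.mul_smul,
    trace_smul, ← mul_kronecker_mul, trace_kronecker, smul_eq_mul]

theorem IsChannel.trace_zero_mul {d : ℕ} (X : OpBasis d) {F : SuperOp (Fin d)}
    (hF : IsChannel F) (i : Fin (d ^ 2 - 1)) : ((X.X none)ᴴ * F (X.X (some i))).trace = 0 := by
  have h := X.orthonormal none (some i)
  rw [if_neg (by simp)] at h
  rw [X.conjTranspose_zero, X.zero, Matrix.smul_mul, Matrix.one_mul, trace_smul] at h ⊢
  rw [hF.2, h]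

/-- A local channel sends traceless operators to traceless operators, so no term of the mixture
reaches a sector that is trivial on a system where the input is not. The hypothesis singles out
these pairs of sectors. -/
theorem IsSeparableChannel.subU_eq_zero (hE : IsSeparableChannel E) {s t : Sector}
    (hst : ∀ p q : PairIx dA dB, InSector t p → InSector s q →
      (p.1 = none ∧ q.1 ≠ none) ∨ (p.2 = none ∧ q.2 ≠ none)) : subU X Y E s t = 0 := by
  obtain ⟨r, c, F, G, hF, hG, h⟩ := hE.exists_liouvilleIn_eq_sum (X := X) (Y := Y)
  rw [subU_eq_sum, Finset.sum_eq_zero, mul_zero]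
  intro p hp
  refine Finset.sum_eq_zero fun q hq => ?_
  rw [h, Finset.sum_eq_zero, norm_zero, zero_pow two_ne_zero]
  intro k _
  rcases hst p q (mem_sectorSet.mp hp) (mem_sectorSet.mp hq) with ⟨h₁, h₂⟩ | ⟨h₁, h₂⟩
  · obtain ⟨i, hi⟩ := Option.ne_none_iff_exists'.mp h₂
    rw [h₁, hi, (hF k).trace_zero_mul, zero_mul, mul_zero]
  · obtain ⟨i, hi⟩ := Option.ne_none_iff_exists'.mp h₂
    rw [h₁, hi, (hG k).trace_zero_mul, mul_zero, mul_zero]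

theorem IsSeparableChannel.subUMatrix_eq (hE : IsSeparableChannel E) : subUMatrix X Y E =
    !![subU X Y E .A .A, 0, 0;
      √(alpha dB) * subU X Y E .A .AB, subU X Y E .AB .AB, √(alpha dA) * subU X Y E .B .AB;
      0, 0, subU X Y E .B .B] := by
  have h₁ : subU X Y E .AB .A = 0 := hE.subU_eq_zero fun p q hp hq => by
    simp_all [InSector, Option.isSome_iff_ne_none]
  have h₂ : subU X Y E .B .A = 0 := hE.subU_eq_zero fun p q hp hq => by
    simp_all [InSector, Option.isSome_iff_ne_none]
  have h₃ : subU X Y E .A .B = 0 := hE.subU_eq_zero fun p q hp hq => by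
    simp_all [InSector, Option.isSome_iff_ne_none]
  have h₄ : subU X Y E .AB .B = 0 := hE.subU_eq_zero fun p q hp hq => by
    simp_all [InSector, Option.isSome_iff_ne_none]
  simp only [subUMatrix, h₁, h₂, h₃, h₄, mul_zero]

theorem IsSeparableChannel.charpoly_subUMatrix (hE : IsSeparableChannel E) :
    (subUMatrix X Y E).charpoly =
      (Polynomial.X - Polynomial.C (subU X Y E .A .A)) *
        (Polynomial.X - Polynomial.C (subU X Y E .B .B)) *
        (Polynomial.X - Polynomial.C (subU X Y E .AB .AB)) := by
  rw [hE.subUMatrix_eq, Matrix.charpoly, det_fin_three]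
  simp
  ring

/-- By Cayley–Hamilton each `lam i` is a root of the characteristic polynomial, which is already
factored. -/
theorem IsSeparableChannel.mem_of_isDiagonalizedBy (hE : IsSeparableChannel E) {lam : Fin 3 → ℂ}
    (hlam : IsDiagonalizedBy (subUMatrixC X Y E) lam) (i : Fin 3) :
    ∃ j, ![(subU X Y E .A .A : ℂ), (subU X Y E .B .B : ℂ), (subU X Y E .AB .AB : ℂ)] j =
      lam i := by
  have h := (hlam.aeval_eq_zero_iff _).mp (Matrix.aeval_self_charpoly _) i
  have hmap : (subUMatrixC X Y E).charpoly =
      (subUMatrix X Y E).charpoly.map Complex.ofRealHom :=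
    Matrix.charpoly_map (subUMatrix X Y E) Complex.ofRealHom
  rw [hmap, hE.charpoly_subUMatrix] at h
  simp only [Polynomial.map_mul, Polynomial.map_sub, Polynomial.map_X, Polynomial.map_C,
    Polynomial.eval_mul, Polynomial.eval_sub, Polynomial.eval_X, Polynomial.eval_C, mul_eq_zero,
    sub_eq_zero] at h
  rcases h with (h | h) | h
  exacts [⟨0, h.symm⟩, ⟨1, h.symm⟩, ⟨2, h.symm⟩]

end Separable

end LocalTwirl

theorem mainTheorem4 (dA dB : ℕ) (hA : 2 ≤ dA) (hB : 2 ≤ dB)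
    (E : SuperOp (Fin dA × Fin dB)) (hE : IsChannel E)
    (ρ : Matrix (Fin dA × Fin dB) (Fin dA × Fin dB) ℂ) (hρ : IsState ρ)
    (M : Matrix (Fin dA × Fin dB) (Fin dA × Fin dB) ℂ) (hM : M.IsHermitian)
    (X : OpBasis dA) (Y : OpBasis dB) :
    -- the local twirls are the orthogonal projectors onto `span {1 ⊗ 1, F}`, and the twirl of
    -- the joint system is their tensor product
    (IsOrthProj (twirl (Fin dA))
        (Submodule.span ℂ {vectorizeTwo 1, vectorizeTwo (flipOp (Fin dA))}) ∧
      IsOrthProj (twirl (Fin dB))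
        (Submodule.span ℂ {vectorizeTwo 1, vectorizeTwo (flipOp (Fin dB))}) ∧
      ∀ p q, localTwirl (Fin dA) (Fin dB) p q =
        twirl (Fin dA) (partA p) (partA q) * twirl (Fin dB) (partB p) (partB q)) ∧
    -- the benchmarking signal
    (∀ (NA NB : ℕ) (ΓA : Fin NA → Matrix.unitaryGroup (Fin dA) ℂ)
        (ΓB : Fin NB → Matrix.unitaryGroup (Fin dB) ℂ), IsTwoDesign ΓA → IsTwoDesign ΓB →
      (∀ k : ℕ, 2 ≤ k → signal E ΓA ΓB M ρ k =
        star (vecTensor M M) ⬝ᵥ (twirled E ^ (k - 1) *ᵥ vecTensor (E ρ) (E ρ))) ∧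
      signal E ΓA ΓB M ρ 1 =
        star (vecTensor M M) ⬝ᵥ (localTwirl (Fin dA) (Fin dB) *ᵥ vecTensor (E ρ) (E ρ))) ∧
    -- the matrix of `P_AB E^{⊗2} P_AB` in an orthonormal basis of the range of `P_AB`
    ((∀ i j, star (basisKet X Y i) ⬝ᵥ basisKet X Y j = if i = j then 1 else 0) ∧
      localTwirl (Fin dA) (Fin dB) =
        ∑ i, Matrix.vecMulVec (basisKet X Y i) (star (basisKet X Y i)) ∧
      (Matrix.of fun i j => star (basisKet X Y i) ⬝ᵥ (twirled E *ᵥ basisKet X Y j)) =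
        Matrix.fromBlocks 1 0 (Matrix.of fun i _ => (blochColumn X Y E i : ℂ))
          (subUMatrixC X Y E)) ∧
    -- decay law when the matrix of sub-unitarities is diagonalizable
    (∀ lam : Fin 3 → ℂ, IsDiagonalizedBy (subUMatrixC X Y E) lam →
      ∃ (c₀ : ℂ) (c : Fin 3 → ℂ),
        ∀ (NA NB : ℕ) (ΓA : Fin NA → Matrix.unitaryGroup (Fin dA) ℂ)
          (ΓB : Fin NB → Matrix.unitaryGroup (Fin dB) ℂ), IsTwoDesign ΓA → IsTwoDesign ΓB →
        ∀ k : ℕ, 1 ≤ k → signal E ΓA ΓB M ρ k = c₀ + ∑ i, c i * lam i ^ (k - 1)) ∧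
    -- decay law in general
    (∃ (c₀ : ℂ) (c : ℂ → ℕ → ℂ),
      ∀ (NA NB : ℕ) (ΓA : Fin NA → Matrix.unitaryGroup (Fin dA) ℂ)
        (ΓB : Fin NB → Matrix.unitaryGroup (Fin dB) ℂ), IsTwoDesign ΓA → IsTwoDesign ΓB →
      ∀ k : ℕ, 1 ≤ k → signal E ΓA ΓB M ρ k =
        c₀ + ∑ z ∈ (subUMatrixC X Y E).charpoly.roots.toFinset,
          ∑ j ∈ Finset.range ((subUMatrixC X Y E).charpoly.roots.count z),
            c z j * ((k - 1).choose j : ℂ) * z ^ (k - 1 - j)) ∧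
    -- separable channels
    (IsSeparableChannel E →
      subUMatrix X Y E =
        !![subU X Y E .A .A, 0, 0;
          √(alpha dB) * subU X Y E .A .AB, subU X Y E .AB .AB, √(alpha dA) * subU X Y E .B .AB;
          0, 0, subU X Y E .B .B] ∧
      (∀ i j : Fin 3, i < j →
        (subUMatrix X Y E).submatrix ![0, 2, 1] ![0, 2, 1] i j = 0) ∧
      (subUMatrix X Y E).charpoly =
        (Polynomial.X - Polynomial.C (subU X Y E .A .A)) * (Polynomial.X - Polynomial.C (subU X Y E .B .B)) *
          (Polynomial.X - Polynomial.C (subU X Y E .AB .AB)) ∧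
      ((∃ lam : Fin 3 → ℂ, IsDiagonalizedBy (subUMatrixC X Y E) lam) →
        ∃ c₀₀ c₁₀ c₀₁ c₁₁ : ℝ,
          ∀ (NA NB : ℕ) (ΓA : Fin NA → Matrix.unitaryGroup (Fin dA) ℂ)
            (ΓB : Fin NB → Matrix.unitaryGroup (Fin dB) ℂ), IsTwoDesign ΓA → IsTwoDesign ΓB →
          ∀ k : ℕ, 1 ≤ k → signal E ΓA ΓB M ρ k =
            ((c₀₀ + c₁₀ * subU X Y E .A .A ^ (k - 1) + c₀₁ * subU X Y E .B .B ^ (k - 1) +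
              c₁₁ * subU X Y E .AB .AB ^ (k - 1) : ℝ) : ℂ))) := by
  have : Nontrivial (Fin dA) := Fin.nontrivial_iff_two_le.mpr hA
  have : Nontrivial (Fin dB) := Fin.nontrivial_iff_two_le.mpr hB
  refine ⟨⟨isOrthProj_twirl, isOrthProj_twirl, localTwirl_apply⟩, ?_,
    ⟨basisKet_orthonormal X Y hA hB, localTwirl_eq_sum_basisKet X Y hA hB,
      twirled_matrix X Y hE hA hB⟩, ?_, ?_, ?_⟩
  · intro NA NB ΓA ΓB hΓA hΓB
    refine ⟨fun k hk => ?_, ?_⟩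
    -- For `k ≥ 2` the power `k - 1` is positive and absorbs the trailing local twirl; at `k = 1`
    -- the twirl survives as the zeroth power.
    · obtain ⟨n, rfl⟩ := Nat.exists_eq_add_of_le' hk
      rw [show n + 2 - 1 = n + 1 by omega, signal_succ hM hΓA hΓB, pow_succ, Matrix.mul_assoc,
        twirled_mul_localTwirl]
    · have := signal_succ (E := E) (ρ := ρ) hM hΓA hΓB 0
      rwa [pow_zero, Matrix.one_mul, zero_add] at this
  · intro lam hlam
    exact exists_signal_eq_sum_pow hρ hE hM hA hB X Y hlam fun i => ⟨i, rfl⟩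
  · obtain ⟨c₀, g, hg, h⟩ := exists_signal_eq_const_add (ρ := ρ) hρ hE hM hA hB X Y _
      (Matrix.aeval_self_charpoly (subUMatrixC X Y E))
    obtain ⟨c, hc⟩ := eq_sum_of_aeval_monic (Matrix.charpoly_monic _) g hg
    exact ⟨c₀, c, fun NA NB ΓA ΓB hΓA hΓB k hk => by rw [h NA NB ΓA ΓB hΓA hΓB k hk, hc]⟩
  · intro hsep
    refine ⟨hsep.subUMatrix_eq, ?_, hsep.charpoly_subUMatrix, ?_⟩
    · intro i j hij
      rw [hsep.subUMatrix_eq]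
      fin_cases i <;> fin_cases j <;> simp at hij ⊢
    · rintro ⟨lam, hlam⟩
      obtain ⟨c₀, c, h⟩ := exists_signal_eq_sum_pow (ρ := ρ) hρ hE hM hA hB X Y
        (u := ![(subU X Y E .A .A : ℂ), (subU X Y E .B .B : ℂ), (subU X Y E .AB .AB : ℂ)]) hlam
        (hsep.mem_of_isDiagonalizedBy hlam)
      -- The signal and the sub-unitarities are real, so the real parts of the complex constants
      -- serve.
      refine ⟨c₀.re, (c 0).re, (c 1).re, (c 2).re, fun NA NB ΓA ΓB hΓA hΓB k hk => ?_⟩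
      rw [signal_eq_ofReal_re hρ hE hM, h NA NB ΓA ΓB hΓA hΓB k hk]
      congr 1
      simp [Fin.sum_univ_three, ← Complex.ofReal_pow]
      ring
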